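/- A halving line of a finite set $P\subset\mathbb{R}^2$ with no three points collinear is a line that passes through two points of $P$ and has numbers of points of $P$ on its two open sides that differ by at most one. Let $h_2(n)$ be the maximum number of halving lines of an $n$-point set in $\mathbb{R}^2$ with no three points collinear. A set $H$ of planes in $\mathbb{R}^3$ is in general position if all its planes are non-vertical, every three of them meet in a unique point, and no point lies on more than three of them. For such a finite set $H$ and an integer $k\ge 1$, the $k$-level of the arrangement $\mathcal{A}(H)$ is the closure of the set of points that lie on a unique plane of $H$ and have exactly $k-1$ planes of $H$ below them. The point dual to the non-vertical plane $z=p_1x+p_2y-p_3$ is $(p_1,p_2,p_3)$; for a set $H$ of non-vertical planes let $H^*$ be the set of dual points. Let $R$ and $B$ be disjoint sets of planes with $R\cup B$ in general position and $|R\cup B|=n$ such that $R^*$ and $B^*$ are strictly separated by a plane, i.e., contained in the two different open half-spaces bounded by some plane. Let $L$ be the intersection of a level of $\mathcal{A}(R)$ with a level of $\mathcal{A}(B)$ (the two levels may have different indices). The complexity of $L$ is the number of vertices plus the number of edges of $\mathcal{A}(R\cup B)$ that are contained in $L$. Let $\ell^*(n)$ be the maximum complexity of $L$ over all such $R$, $B$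 and all pairs of levels. Then both maxima $h_2(n)$ and $\ell^*(n)$ exist and are finite for every $n$, and $$\ell^*(n)=\Theta\bigl(n\,h_2(n)\bigr)\qquad (n\to\infty).$$ -/

import Mathlib

open Filter Asymptotics

/-! ### Halving lines in the plane -/

/-- The Euclidean plane. -/
abbrev Plane2 : Type := EuclideanSpace ℝ (Fin 2)

/-- The line `{x | ⟪v, x⟫ = a}` in the plane, with normal vector `v`. -/
def line2 (v : Plane2) (a : ℝ) : Set Plane2 := {x | inner ℝ v x = a}

/-- No three distinct points of `P` are collinear. -/
def GeneralPosition2 (P : Set Plane2) : Prop :=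
  ∀ p ∈ P, ∀ q ∈ P, ∀ r ∈ P, p ≠ q → p ≠ r → q ≠ r → ¬ Collinear ℝ {p, q, r}

/-- The halving lines of `P`: lines through exactly two points of `P` such that the numbers of
points of `P` in the two open half-planes differ by at most one. -/
def halvingLines (P : Set Plane2) : Set (Set Plane2) :=
  {L | ∃ (v : Plane2) (a : ℝ), v ≠ 0 ∧ L = line2 v a ∧ (P ∩ L).encard = 2 ∧
    {x ∈ P | inner ℝ v x < a}.encard ≤ {x ∈ P | a < inner ℝ v x}.encard + 1 ∧
    {x ∈ P | a < inner ℝ v x}.encard ≤ {x ∈ P | inner ℝ v x < a}.encard + 1}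

/-- The numbers of halving lines of `n`-point sets in general position in the plane. -/
def halvingLineCounts (n : ℕ) : Set ℕ∞ :=
  {c | ∃ P : Set Plane2, P.encard = n ∧ GeneralPosition2 P ∧ c = (halvingLines P).encard}

/-- `h₂(n)`: the maximum number of halving lines of an `n`-point set in the plane. -/
noncomputable def h₂ (n : ℕ) : ℕ∞ := sSup (halvingLineCounts n)

/-! ### Planes, arrangements and levels in space -/

/-- Euclidean three-space; the coordinates `x 0`, `x 1`, `x 2` are `x`, `y`, `z`. -/
abbrev Space3 : Type := EuclideanSpace ℝ (Fin 3)

/-- The plane `{x | ⟪v, x⟫ = a}` with normal vector `v`. -/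
def plane3 (v : Space3) (a : ℝ) : Set Space3 := {x | inner ℝ v x = a}

/-- A plane that is not parallel to the `z`-axis. -/
def IsNonverticalPlane (S : Set Space3) : Prop :=
  ∃ (v : Space3) (a : ℝ), v 2 ≠ 0 ∧ S = plane3 v a

/-- General position of a set of planes: all planes are non-vertical, any three of them meet in a
unique point, and no point lies on more than three of them. -/
def GeneralPosition3 (H : Set (Set Space3)) : Prop :=
  (∀ S ∈ H, IsNonverticalPlane S) ∧
  (∀ S₁ ∈ H, ∀ S₂ ∈ H, ∀ S₃ ∈ H, S₁ ≠ S₂ → S₁ ≠ S₃ → S₂ ≠ S₃ →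
    ∃! x, x ∈ S₁ ∧ x ∈ S₂ ∧ x ∈ S₃) ∧
  (∀ x, {S ∈ H | x ∈ S}.encard ≤ 3)

/-- The plane dual to the point `p`: `z = p₁ x + p₂ y - p₃`. -/
def dualPlane (p : Space3) : Set Space3 := {x | x 2 = p 0 * x 0 + p 1 * x 1 - p 2}

/-- The set of points dual to a set `H` of non-vertical planes. -/
def dualPoints (H : Set (Set Space3)) : Set Space3 := {p | dualPlane p ∈ H}

/-- `P` and `Q` lie in the two different open half-spaces bounded by some plane. -/
def StrictlySeparated (P Q : Set Space3) : Prop :=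
  ∃ (v : Space3) (a : ℝ), v ≠ 0 ∧ (∀ p ∈ P, inner ℝ v p < a) ∧ (∀ q ∈ Q, a < inner ℝ v q)

/-- The non-vertical plane `S` passes strictly below the point `x`. -/
def PassesBelow (S : Set Space3) (x : Space3) : Prop :=
  ∃ y ∈ S, y 0 = x 0 ∧ y 1 = x 1 ∧ y 2 < x 2

/-- The `k`-level of the arrangement of `H`: the closure of the set of points that lie on a unique
plane of `H` and have exactly `k - 1` planes of `H` below them. -/
def kLevel (H : Set (Set Space3)) (k : ℕ) : Set Space3 :=
  closure {x | (∃! S, S ∈ H ∧ x ∈ S) ∧ {S ∈ H | PassesBelow S x}.encard + 1 = k}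

/-- The (relatively open) cell of the arrangement of `H` that contains `x`: all points with the same
position (below, on, above) as `x` relative to every plane of `H`. -/
def cellOf (H : Set (Set Space3)) (x : Space3) : Set Space3 :=
  {y | ∀ S ∈ H, (y ∈ S ↔ x ∈ S) ∧ (PassesBelow S y ↔ PassesBelow S x)}

/-- The `d`-dimensional cells of the arrangement of `H`: vertices for `d = 0`, edges for `d = 1`. -/
def cells (H : Set (Set Space3)) (d : ℕ) : Set (Set Space3) :=
  {F | (∃ x, F = cellOf H x) ∧ Module.finrank ℝ (vectorSpan ℝ F) = d}

/-- The complexity of the intersection of the `k`-level of the arrangement of `R` with the `k'`-level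
of the arrangement of `B`: the number of vertices plus the number of edges of the arrangement
of `R ∪ B` contained in it. -/
noncomputable def intersectionComplexity (R B : Set (Set Space3)) (k k' : ℕ) : ℕ∞ :=
  {F ∈ cells (R ∪ B) 0 | F ⊆ kLevel R k ∩ kLevel B k'}.encard +
    {F ∈ cells (R ∪ B) 1 | F ⊆ kLevel R k ∩ kLevel B k'}.encard

/-- The complexities of the intersection of a level of the arrangement of `R` with a level of the
arrangement of `B`, over all disjoint `R` and `B` with `n` planes in total, in general position, whose
dual point sets are strictly separated by a plane. -/
def separatedComplexities (n : ℕ) : Set ℕ∞ :=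
  {c | ∃ (R B : Set (Set Space3)) (k k' : ℕ), Disjoint R B ∧ (R ∪ B).encard = n ∧
    GeneralPosition3 (R ∪ B) ∧ StrictlySeparated (dualPoints R) (dualPoints B) ∧
    c = intersectionComplexity R B k k'}

/-- `ℓ*(n)`: the maximum of these complexities. -/
noncomputable def ellStar (n : ℕ) : ℕ∞ := sSup (separatedComplexities n)

/-! The link between space and plane is central projection in the dual. A point `x` on planes `b`,
`r₁`, `r₂` is dual to the plane through the three dual points, and a further plane passes below `x`
according to the side on which its dual point lies (`volume4_eq_shadow_mul_height`). Seen from the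
dual point of `b`, the dual points of `R` form a vector configuration. As `R` and `B` are separated
it lies in a half-space, so it is a planar point set, and the vertices of a level of `R` on `b`
become pairs of points with a prescribed number of points on one side: the edges counted by
`levelEdges`.

The planar input compares all levels and nearby sizes with halving lines. `EdgeBound m C` bounds the
edges at every level for at most `m` points. Adding points at vertical infinity turns an arbitrary
level into the middle one, at the price of halving the size (`edgeBound_of_two_mul_le`). The size is
regained by `EdgeBound.enlarge`: two crossing lines cut the set into four almost equal parts, every
line misses one of them, and deleting a missed part shifts the level by a constant. Together these
give `edgeBound_of_le_three_mul`: every level of `n ≤ 3m` points has `O(h₂ m)` edges, for large `m`.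

Upper bound: every vertex of the intersection lies on two planes of one colour and one of the other.
Summing the planar bound over the plane of the other colour gives `O(n h₂ n)` vertices
(`EdgeBound.exists_finset_of_levelPoints`). Every edge of the intersection ends in such a vertex,
and a vertex belongs to boundedly many cells (`encard_edges_le`).

Lower bound: an extremal planar set is flattened towards a line in space, and an alternating set of
`2j+1` points is placed so that every plane through that line and one of these points halves them
(`exists_spatial_configuration`). Each pair of a halving edge and an alternating point yields a
vertex of one fixed intersection of levels (`mul_le_two_mul_ellStar`). Taking both colour classes of
size about `n/2` and comparing `h₂ n` with `h₂ m` finishes the proof. -/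

open Topology

/-! ### Perturbation along the moment curve -/

/-- The vectors `v i`, moved by `t` times the points `(1, s i, (s i)², …)` of the moment curve. -/
def perturb {d : ℕ} {ι : Type*} (v : ι → Fin d → ℝ) (s : ι → ℝ) (t : ℝ) (i : ι) : Fin d → ℝ :=
  fun j => v i j + t * s i ^ (j : ℕ)

theorem continuous_perturb {d : ℕ} {ι : Type*} (v : ι → Fin d → ℝ) (s : ι → ℝ) (i : ι) (j : Fin d) :
    Continuous fun t => perturb v s t i j := by
  unfold perturb; fun_prop

theorem perturb_zero {d : ℕ} {ι : Type*} (v : ι → Fin d → ℝ) (s : ι → ℝ) (i : ι) :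
    perturb v s 0 i = v i := by
  ext j; simp [perturb]

/-- Each determinant is a polynomial in `t` whose coefficient of degree `d` is a Vandermonde
determinant of distinct nodes. Hence it has finitely many zeros, and small positive `t` avoid them
all. -/
theorem eventually_det_perturb_ne_zero {d : ℕ} {ι : Type*} [Finite ι] (v : ι → Fin d → ℝ)
    {s : ι → ℝ} (hs : Function.Injective s) :
    ∀ᶠ t in 𝓝[>] (0 : ℝ), ∀ f : Fin d → ι, Function.Injective f →
      (Matrix.of fun a => perturb v s t (f a)).det ≠ 0 := by
  rw [eventually_all]
  intro f
  by_cases hf : Function.Injective f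
  swap
  · exact Eventually.of_forall fun t h => absurd h hf
  set A : Matrix (Fin d) (Fin d) ℝ := Matrix.of fun a j => v (f a) j
  set V : Matrix (Fin d) (Fin d) ℝ := Matrix.vandermonde (s ∘ f)
  set P : Polynomial ℝ :=
    ((Polynomial.X : Polynomial ℝ) • V.map Polynomial.C + A.map Polynomial.C).det with hP
  have hV : V.det ≠ 0 := Matrix.det_vandermonde_ne_zero_iff.2 (hs.comp hf)
  have hP0 : P ≠ 0 := by
    intro h
    have := Polynomial.coeff_det_X_add_C_card V A
    rw [← hP, h] at this
    exact hV (by simpa using this.symm)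
  have hev : ∀ t, P.eval t = (Matrix.of fun a => perturb v s t (f a)).det := by
    intro t
    rw [hP, ← Polynomial.coe_evalRingHom, RingHom.map_det]
    congr 1
    ext a j
    simp [A, V, perturb, Matrix.vandermonde_apply, add_comm]
  have hfin : {t : ℝ | P.eval t = 0}.Finite := by
    refine (P.roots.toFinset.finite_toSet).subset fun t ht => ?_
    simpa [hP0] using ht
  have h1 : ∀ᶠ t in 𝓝[>] (0 : ℝ), t ∈ {t : ℝ | P.eval t = 0}ᶜ :=
    (nhdsWithin_mono _ (fun x hx => ne_of_gt hx)).trans (nhdsNE_le_cofinite (a := (0 : ℝ)))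
      hfin.compl_mem_cofinite
  filter_upwards [h1] with t ht _
  rw [← hev]
  exact ht

/-! ### Planar configurations -/

/-- Twice the signed area of the triangle `p q r`. -/
def orient (p q r : ℝ × ℝ) : ℝ := (q.1 - p.1) * (r.2 - p.2) - (q.2 - p.2) * (r.1 - p.1)

/-- The determinant of three vectors in space. -/
def det3 (u v w : Fin 3 → ℝ) : ℝ :=
  u 0 * (v 1 * w 2 - v 2 * w 1) - u 1 * (v 0 * w 2 - v 2 * w 0) + u 2 * (v 0 * w 1 - v 1 * w 0)

/-- A planar configuration with distinct first coordinates and without collinear triples. -/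
structure GenPos {ι : Type*} (p : ι → ℝ × ℝ) : Prop where
  fst_injective : Function.Injective fun i => (p i).1
  orient_ne_zero : ∀ i j k, i ≠ j → i ≠ k → j ≠ k → orient (p i) (p j) (p k) ≠ 0

theorem det3_eq_det (u v w : Fin 3 → ℝ) : det3 u v w = (Matrix.of ![u, v, w]).det := by
  simp [Matrix.det_fin_three, det3]; ring

theorem injective_vec3 {ι : Type*} {i j k : ι} (hij : i ≠ j) (hik : i ≠ k) (hjk : j ≠ k) :
    Function.Injective ![i, j, k] := by
  intro a b h
  fin_cases a <;> fin_cases b <;> simp_all [eq_comm]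

theorem injective_vec2 {ι : Type*} {i j : ι} (hij : i ≠ j) : Function.Injective ![i, j] := by
  intro a b h
  fin_cases a <;> fin_cases b <;> simp_all [eq_comm]

theorem exists_injective_real (ι : Type*) [Finite ι] : ∃ s : ι → ℝ, Function.Injective s := by
  obtain ⟨n, ⟨e⟩⟩ := Finite.exists_equiv_fin ι
  exact ⟨fun i => ((e i : ℕ) : ℝ), fun i j h => e.injective (Fin.ext (Nat.cast_injective (R := ℝ) h))⟩

theorem eventually_pos_of_continuous {g : ℝ → ℝ} (hg : Continuous g) (h : 0 < g 0) :
    ∀ᶠ t in 𝓝[>] (0 : ℝ), 0 < g t :=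
  (hg.continuousAt.eventually (lt_mem_nhds h)).filter_mono nhdsWithin_le_nhds

theorem eventually_neg_of_continuous {g : ℝ → ℝ} (hg : Continuous g) (h : g 0 < 0) :
    ∀ᶠ t in 𝓝[>] (0 : ℝ), g t < 0 :=
  (hg.continuousAt.eventually (gt_mem_nhds h)).filter_mono nhdsWithin_le_nhds

/-- The affine point with given homogeneous coordinates (the first one is the weight). -/
noncomputable def dehomogenize (w : Fin 3 → ℝ) : ℝ × ℝ := (w 1 / w 0, w 2 / w 0)

theorem orient_dehomogenize {u v w : Fin 3 → ℝ} (hu : 0 < u 0) (hv : 0 < v 0) (hw : 0 < w 0) :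
    orient (dehomogenize u) (dehomogenize v) (dehomogenize w) =
      det3 u v w / (u 0 * v 0 * w 0) := by
  unfold orient dehomogenize det3
  field_simp
  ring

/-- Every finite vector configuration in a closed half-space can be perturbed to a planar
configuration in general position that has the same orientations of triples. -/
theorem exists_genPos_of_vectors {ι : Type*} [Finite ι] (v : ι → Fin 3 → ℝ) (h0 : ∀ i, 0 ≤ v i 0) :
    ∃ q : ι → ℝ × ℝ, GenPos q ∧ ∀ i j k,
      (0 < det3 (v i) (v j) (v k) → 0 < orient (q i) (q j) (q k)) ∧
      (det3 (v i) (v j) (v k) < 0 → orient (q i) (q j) (q k) < 0) := by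
  obtain ⟨s, hs⟩ := exists_injective_real ι
  have h3 := eventually_det_perturb_ne_zero v hs
  -- Truncated moment curve points are again on a moment curve; the determinants of size two
  -- separate the first affine coordinates.
  have h2 := eventually_det_perturb_ne_zero (d := 2) (fun i j => v i (Fin.castSucc j)) hs
  have hc : ∀ i j k, Continuous fun t =>
      det3 (perturb v s t i) (perturb v s t j) (perturb v s t k) := by
    intro i j k
    have := continuous_perturb v s
    unfold det3
    fun_prop (disch := assumption)
  have hp : ∀ᶠ t in 𝓝[>] (0 : ℝ), ∀ i j k, 0 < det3 (v i) (v j) (v k) →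
      0 < det3 (perturb v s t i) (perturb v s t j) (perturb v s t k) := by
    simp only [eventually_all]
    intro i j k h
    exact eventually_pos_of_continuous (hc i j k) (by simpa only [perturb_zero] using h)
  have hn : ∀ᶠ t in 𝓝[>] (0 : ℝ), ∀ i j k, det3 (v i) (v j) (v k) < 0 →
      det3 (perturb v s t i) (perturb v s t j) (perturb v s t k) < 0 := by
    simp only [eventually_all]
    intro i j k h
    exact eventually_neg_of_continuous (hc i j k) (by simpa only [perturb_zero] using h)
  obtain ⟨t, h3, h2, hp, hn, ht⟩ :=
    (h3.and (h2.and (hp.and (hn.and self_mem_nhdsWithin)))).exists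
  have ht : 0 < t := ht
  -- The weight grows by exactly `t`, so points at infinity (weight 0) become finite.
  have hw : ∀ i, 0 < perturb v s t i 0 := fun i => by
    have := h0 i
    simp only [perturb, Fin.val_zero, pow_zero, mul_one]; linarith
  refine ⟨fun i => dehomogenize (perturb v s t i), ⟨?_, ?_⟩, ?_⟩
  · intro i j hij
    by_contra hne
    apply h2 ![i, j] (injective_vec2 hne)
    have hij : perturb v s t i 1 / perturb v s t i 0 = perturb v s t j 1 / perturb v s t j 0 := hij
    rw [div_eq_div_iff (hw i).ne' (hw j).ne'] at hij
    simp only [perturb, Fin.val_zero, Fin.val_one] at hij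
    simp [Matrix.det_fin_two, perturb] at hij ⊢
    linarith
  · intro i j k hij hik hjk
    rw [orient_dehomogenize (hw i) (hw j) (hw k)]
    refine div_ne_zero ?_ (mul_pos (mul_pos (hw i) (hw j)) (hw k)).ne'
    have := h3 ![i, j, k] (injective_vec3 hij hik hjk)
    rw [det3_eq_det]
    convert this using 3
    ext a
    fin_cases a <;> rfl
  · intro i j k
    dsimp only
    rw [orient_dehomogenize (hw i) (hw j) (hw k)]
    have hpos := mul_pos (mul_pos (hw i) (hw j)) (hw k)
    exact ⟨fun h => div_pos (hp i j k h) hpos, fun h => div_neg_of_neg_of_pos (hn i j k h) hpos⟩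

/-- The ordered pairs `(i, j)` with exactly `a` indices `k` such that `D i j k` is positive. -/
noncomputable def levelEdges {ι : Type*} [Fintype ι] (D : ι → ι → ι → ℝ) (a : ℕ) :
    Finset (ι × ι) := by
  classical
  exact Finset.univ.filter fun e => e.1 ≠ e.2 ∧ (Finset.univ.filter fun k => 0 < D e.1 e.2 k).card = a

theorem mem_levelEdges {ι : Type*} [Fintype ι] {D : ι → ι → ι → ℝ} {a : ℕ} {e : ι × ι} :
    e ∈ levelEdges D a ↔ e.1 ≠ e.2 ∧
      (Finset.univ.filter fun k => 0 < D e.1 e.2 k).card = a := by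
  classical
  simp [levelEdges]

/-- The orientations of the triples of a planar configuration. -/
def chirotope {ι : Type*} (p : ι → ℝ × ℝ) (i j k : ι) : ℝ := orient (p i) (p j) (p k)

theorem levelEdges_congr {ι : Type*} [Fintype ι] {D D' : ι → ι → ι → ℝ}
    (h : ∀ i j k, 0 < D i j k ↔ 0 < D' i j k) (a : ℕ) : levelEdges D a = levelEdges D' a := by
  ext e; simp only [mem_levelEdges, h]

theorem orient_self_left (p q : ℝ × ℝ) : orient p q p = 0 := by simp [orient]

theorem orient_self_right (p q : ℝ × ℝ) : orient p q q = 0 := by simp [orient]; ring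

theorem orient_swap (p q r : ℝ × ℝ) : orient q p r = - orient p q r := by simp [orient]; ring

theorem GenPos.orient_eq_zero_iff {ι : Type*} {p : ι → ℝ × ℝ} (hp : GenPos p) {i j k : ι}
    (hij : i ≠ j) : orient (p i) (p j) (p k) = 0 ↔ k = i ∨ k = j := by
  constructor
  · intro h
    by_contra! hk
    exact hp.orient_ne_zero i j k hij hk.1.symm hk.2.symm h
  · rintro (rfl | rfl)
    · exact orient_self_left _ _
    · exact orient_self_right _ _

theorem GenPos.card_left_add_card_right {ι : Type*} [Fintype ι] {p : ι → ℝ × ℝ} (hp : GenPos p)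
    {i j : ι} (hij : i ≠ j) :
    (Finset.univ.filter fun k => 0 < orient (p i) (p j) (p k)).card +
      (Finset.univ.filter fun k => orient (p i) (p j) (p k) < 0).card + 2 = Fintype.card ι := by
  classical
  have h0 : (Finset.univ.filter fun k => orient (p i) (p j) (p k) = 0) = {i, j} := by
    ext k; simp [hp.orient_eq_zero_iff hij]
  have h2 : (Finset.univ.filter fun k => orient (p i) (p j) (p k) = 0).card = 2 := by
    rw [h0, Finset.card_pair hij]
  rw [← h2, ← Finset.card_union_of_disjoint, ← Finset.card_union_of_disjoint, ← Finset.card_univ]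
  · congr 1
    ext k
    rcases lt_trichotomy (orient (p i) (p j) (p k)) 0 with h | h | h <;> simp [h]
  · rw [Finset.disjoint_left]; intro k; simp only [Finset.mem_union, Finset.mem_filter]
    rintro (h | h) h' <;> linarith [h.2, h'.2]
  · rw [Finset.disjoint_left]; intro k; simp only [Finset.mem_filter]
    rintro h h'; linarith [h.2, h'.2]

/-! ### Halving lines as level edges -/

/-- The coordinates of a point of the plane. -/
def coords2 (x : Plane2) : ℝ × ℝ := (x 0, x 1)

/-- The point of the plane with given coordinates. -/
noncomputable def ofCoords2 (p : ℝ × ℝ) : Plane2 := !₂[p.1, p.2]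

@[simp] theorem coords2_ofCoords2 (p : ℝ × ℝ) : coords2 (ofCoords2 p) = p := by
  simp [coords2, ofCoords2]

theorem coords2_injective : Function.Injective coords2 := by
  intro x y h
  simp only [coords2, Prod.mk.injEq] at h
  ext i
  fin_cases i
  · exact h.1
  · exact h.2

theorem inner_plane2 (v x : Plane2) : inner ℝ v x = v 0 * x 0 + v 1 * x 1 := by
  simp [PiLp.inner_apply, Fin.sum_univ_two, mul_comm]

theorem Collinear.orient_eq_zero {p q r : Plane2} (h : Collinear ℝ {p, q, r}) :
    orient (coords2 p) (coords2 q) (coords2 r) = 0 := by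
  obtain ⟨v, hv⟩ := (collinear_iff_of_mem (p₀ := p) (by simp)).1 h
  obtain ⟨a, ha⟩ := hv q (by simp)
  obtain ⟨b, hb⟩ := hv r (by simp)
  subst ha hb
  simp [orient, coords2]
  ring

theorem collinear_of_orient_eq_zero {p q r : Plane2} (hpq : p ≠ q)
    (h : orient (coords2 p) (coords2 q) (coords2 r) = 0) : Collinear ℝ {p, q, r} := by
  rw [collinear_iff_of_mem (p₀ := p) (by simp)]
  refine ⟨q - p, ?_⟩
  simp only [orient, coords2] at h
  suffices hr : ∃ t : ℝ, r = t • (q - p) + p by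
    intro x hx
    simp only [Set.mem_insert_iff, Set.mem_singleton_iff] at hx
    rcases hx with rfl | rfl | rfl
    · exact ⟨0, by simp⟩
    · exact ⟨1, by simp⟩
    · simpa using hr
  by_cases h0 : q 0 = p 0
  · have h1 : q 1 - p 1 ≠ 0 := by
      intro h1
      exact hpq (coords2_injective (Prod.ext h0.symm (by simp only [coords2]; linarith)))
    refine ⟨(r 1 - p 1) / (q 1 - p 1), ?_⟩
    ext i
    fin_cases i
    · simp only [h0, sub_self, zero_mul, zero_sub, neg_eq_zero, mul_eq_zero, h1, false_or] at h
      simp [h0]; linarith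
    · simp [h1]
  · have h1 : q 0 - p 0 ≠ 0 := sub_ne_zero.2 h0
    refine ⟨(r 0 - p 0) / (q 0 - p 0), ?_⟩
    ext i
    fin_cases i
    · simp [h1]
    · simp; field_simp; linarith

/-- The normal vector of the line through two points. -/
noncomputable def normal2 (p q : ℝ × ℝ) : Plane2 := !₂[-(q.2 - p.2), q.1 - p.1]

theorem inner_normal2 (p q : ℝ × ℝ) (x : Plane2) :
    inner ℝ (normal2 p q) x = orient p q (coords2 x) + inner ℝ (normal2 p q) (ofCoords2 p) := by
  simp [inner_plane2, normal2, orient, coords2, ofCoords2]; ring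

/-- A linear form vanishing on `q - p` is a multiple of the orientation form. -/
theorem exists_orient_multiple {v p q : Plane2} {a : ℝ} (hv : v ≠ 0) (hpq : p ≠ q)
    (hp : inner ℝ v p = a) (hq : inner ℝ v q = a) :
    ∃ c : ℝ, c ≠ 0 ∧ ∀ x : Plane2,
      inner ℝ v x - a = c * orient (coords2 p) (coords2 q) (coords2 x) := by
  simp only [inner_plane2] at hp hq
  have hv' : ¬ (v 0 = 0 ∧ v 1 = 0) := by
    rintro ⟨h0, h1⟩
    exact hv (by ext i; fin_cases i <;> simp [h0, h1])
  have key : ∀ c : ℝ, v 0 = -c * (q 1 - p 1) → v 1 = c * (q 0 - p 0) →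
      ∃ c : ℝ, c ≠ 0 ∧ ∀ x : Plane2,
        inner ℝ v x - a = c * orient (coords2 p) (coords2 q) (coords2 x) := by
    intro c h0 h1
    refine ⟨c, ?_, fun x => ?_⟩
    · rintro rfl
      exact hv' ⟨by simpa using h0, by simpa using h1⟩
    · rw [inner_plane2, ← hp, h0, h1]
      simp only [orient, coords2]
      ring
  have hd : v 0 * (q 0 - p 0) + v 1 * (q 1 - p 1) = 0 := by linarith
  by_cases h0 : q 0 = p 0
  · have h1 : q 1 - p 1 ≠ 0 := by
      intro h1
      exact hpq (coords2_injective (Prod.ext h0.symm (by simp only [coords2]; linarith)))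
    refine key (-(v 0) / (q 1 - p 1)) (by field_simp) ?_
    simp only [h0, sub_self, mul_zero, zero_add, mul_eq_zero, h1, or_false] at hd ⊢
    exact hd
  · have h1 : q 0 - p 0 ≠ 0 := sub_ne_zero.2 h0
    refine key (v 1 / (q 0 - p 0)) ?_ (by field_simp)
    field_simp
    linarith

/-! ### Counting points through their indices -/

theorem encard_setOf_fintype {ι : Type*} [Fintype ι] (q : ι → Prop) [DecidablePred q] :
    {i | q i}.encard = (Finset.univ.filter q).card := by
  rw [← Set.encard_coe_eq_coe_finsetCard]; simp

theorem encard_sep_eq {α : Type*} {P : Set α} [Fintype P] (q : α → Prop) [DecidablePred q] :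
    {x ∈ P | q x}.encard = (Finset.univ.filter fun i : P => q i).card := by
  rw [← encard_setOf_fintype, ← Subtype.val_injective.encard_image]
  congr 1
  ext x
  simp [and_comm]

theorem encard_sep_range {ι α : Type*} [Fintype ι] {f : ι → α} (hf : Function.Injective f)
    (q : α → Prop) [DecidablePred q] :
    {x ∈ Set.range f | q x}.encard = (Finset.univ.filter fun i => q (f i)).card := by
  rw [← encard_setOf_fintype, ← hf.encard_image]
  congr 1
  ext x
  simp only [Set.mem_range, Set.mem_ofPred_eq, Set.mem_image]
  constructor
  · rintro ⟨⟨i, rfl⟩, h⟩; exact ⟨i, h, rfl⟩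
  · rintro ⟨i, h, rfl⟩; exact ⟨⟨i, rfl⟩, h⟩

theorem encard_range {ι α : Type*} [Fintype ι] {f : ι → α} (hf : Function.Injective f) :
    (Set.range f).encard = Fintype.card ι := by
  rw [← Set.image_univ, hf.encard_image, Set.encard_univ, ENat.card_eq_coe_fintype_card]

theorem GenPos.injective {ι : Type*} {p : ι → ℝ × ℝ} (hp : GenPos p) : Function.Injective p :=
  fun _ _ h => hp.fst_injective (congrArg Prod.fst h)

theorem GenPos.generalPosition2 {ι : Type*} {p : ι → ℝ × ℝ} (hp : GenPos p) :
    GeneralPosition2 (Set.range fun i => ofCoords2 (p i)) := by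
  rintro _ ⟨i, rfl⟩ _ ⟨j, rfl⟩ _ ⟨k, rfl⟩ hij hik hjk hc
  have := hc.orient_eq_zero
  simp only [coords2_ofCoords2] at this
  refine hp.orient_ne_zero i j k ?_ ?_ ?_ this
  · rintro rfl; exact hij rfl
  · rintro rfl; exact hik rfl
  · rintro rfl; exact hjk rfl

theorem injective_ofCoords2_comp {ι : Type*} {p : ι → ℝ × ℝ} (hp : Function.Injective p) :
    Function.Injective fun i => ofCoords2 (p i) := by
  intro i j h
  apply hp
  simpa using congrArg coords2 h

/-! ### Finiteness of `h₂` and its description by middle level edges -/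

theorem encard_halvingLines_le {P : Set Plane2} {n : ℕ} (hP : P.encard = n) :
    (halvingLines P).encard ≤ ((n * n : ℕ) : ℕ∞) := by
  have hPf := Set.finite_of_encard_eq_coe hP
  have hsub : halvingLines P ⊆ (fun e : Plane2 × Plane2 =>
      {x | orient (coords2 e.1) (coords2 e.2) (coords2 x) = 0}) '' (P ×ˢ P) := by
    rintro L ⟨v, a, hv, rfl, h2, -⟩
    obtain ⟨p, q, hpq, hPL⟩ := Set.encard_eq_two.1 h2
    have hp : p ∈ P ∩ line2 v a := by rw [hPL]; simp
    have hq : q ∈ P ∩ line2 v a := by rw [hPL]; simp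
    obtain ⟨c, hc, hx⟩ := exists_orient_multiple hv hpq hp.2 hq.2
    refine ⟨(p, q), ⟨hp.1, hq.1⟩, ?_⟩
    ext x
    have := hx x
    simp only [line2, Set.mem_ofPred_eq]
    rw [← sub_eq_zero (b := a), this]
    simp [hc]
  refine (Set.encard_le_encard hsub).trans ((Set.encard_image_le _ _).trans ?_)
  rw [Set.encard_prod, hP]
  push_cast
  exact le_rfl

theorem halvingLineCounts_nonempty (n : ℕ) : (halvingLineCounts n).Nonempty := by
  obtain ⟨q, hq, -⟩ := exists_genPos_of_vectors (fun (_ : Fin n) (_ : Fin 3) => (0 : ℝ)) (by simp)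
  exact ⟨_, _, by rw [encard_range (injective_ofCoords2_comp hq.injective), Fintype.card_fin],
    hq.generalPosition2, rfl⟩

theorem h₂_le (n : ℕ) : h₂ n ≤ ((n * n : ℕ) : ℕ∞) := by
  refine sSup_le ?_
  rintro c ⟨P, hP, -, rfl⟩
  exact encard_halvingLines_le hP

theorem h₂_ne_top (n : ℕ) : h₂ n ≠ ⊤ := ne_top_of_le_ne_top (ENat.natCast_ne_top _) (h₂_le n)

theorem isGreatest_sSup_of_ne_top {S : Set ℕ∞} (hS : S.Nonempty) (h : sSup S ≠ ⊤) :
    IsGreatest S (sSup S) := by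
  have := hS.to_subtype
  exact ⟨ENat.sSup_mem_of_nonempty_of_lt_top h.lt_top, fun c hc => le_sSup hc⟩

theorem isGreatest_h₂ (n : ℕ) : IsGreatest (halvingLineCounts n) (h₂ n) :=
  isGreatest_sSup_of_ne_top (halvingLineCounts_nonempty n) (h₂_ne_top n)

/-- Level edges at the middle level span halving lines. -/
theorem GenPos.card_levelEdges_middle_le {ι : Type*} [Fintype ι] {p : ι → ℝ × ℝ} (hp : GenPos p) :
    (levelEdges (chirotope p) ((Fintype.card ι - 2) / 2)).card ≤
      2 * (h₂ (Fintype.card ι)).toNat := by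
  classical
  set n := Fintype.card ι
  set P : Set Plane2 := Set.range fun i => ofCoords2 (p i) with hPdef
  have hinj := injective_ofCoords2_comp hp.injective
  have hP : P.encard = n := encard_range hinj
  set E := levelEdges (chirotope p) ((n - 2) / 2)
  set g : ι × ι → Set Plane2 := fun e =>
    line2 (normal2 (p e.1) (p e.2)) (inner ℝ (normal2 (p e.1) (p e.2)) (ofCoords2 (p e.1))) with hg
  have hmem : ∀ e k, e ∈ E → (ofCoords2 (p k) ∈ g e ↔ k = e.1 ∨ k = e.2) := by
    intro e k he
    have := (mem_levelEdges.1 he).1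
    rw [← hp.orient_eq_zero_iff this]
    simp only [hg, line2, Set.mem_ofPred_eq]
    rw [inner_normal2]
    simp
  have hhalv : ∀ e ∈ E, g e ∈ halvingLines P := by
    intro e he
    obtain ⟨hne, hcard⟩ := mem_levelEdges.1 he
    have htot := hp.card_left_add_card_right hne
    refine ⟨_, _, ?_, rfl, ?_, ?_⟩
    · intro h0
      have h1 : (normal2 (p e.1) (p e.2)) 1 = 0 := by rw [h0]; simp
      simp only [normal2] at h1
      have h1 : (p e.2).1 - (p e.1).1 = 0 := by simpa using h1
      exact hne (hp.fst_injective (by dsimp only; linarith))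
    · have : P ∩ g e = {ofCoords2 (p e.1), ofCoords2 (p e.2)} := by
        ext x
        simp only [Set.mem_inter_iff, Set.mem_insert_iff, Set.mem_singleton_iff]
        constructor
        · rintro ⟨⟨k, rfl⟩, hk⟩
          rcases (hmem e k he).1 hk with rfl | rfl <;> simp
        · rintro (rfl | rfl)
          · exact ⟨⟨_, rfl⟩, (hmem e _ he).2 (Or.inl rfl)⟩
          · exact ⟨⟨_, rfl⟩, (hmem e _ he).2 (Or.inr rfl)⟩
      change (P ∩ g e).encard = 2
      rw [this]
      exact Set.encard_pair fun h => hne (hinj h)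
    · have h1 : ∀ k, inner ℝ (normal2 (p e.1) (p e.2)) (ofCoords2 (p k)) =
          orient (p e.1) (p e.2) (p k) +
            inner ℝ (normal2 (p e.1) (p e.2)) (ofCoords2 (p e.1)) := fun k => by
        rw [inner_normal2, coords2_ofCoords2]
      rw [hPdef, encard_sep_range hinj, encard_sep_range hinj]
      generalize inner ℝ (normal2 (p e.1) (p e.2)) (ofCoords2 (p e.1)) = a at h1 ⊢
      have e1 : (Finset.univ.filter fun k =>
          inner ℝ (normal2 (p e.1) (p e.2)) (ofCoords2 (p k)) < a) =
          Finset.univ.filter fun k => orient (p e.1) (p e.2) (p k) < 0 :=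
        Finset.filter_congr fun k _ => by rw [h1]; exact add_lt_iff_neg_right a
      have e2 : (Finset.univ.filter fun k =>
          a < inner ℝ (normal2 (p e.1) (p e.2)) (ofCoords2 (p k))) =
          Finset.univ.filter fun k => 0 < orient (p e.1) (p e.2) (p k) :=
        Finset.filter_congr fun k _ => by rw [h1]; exact lt_add_iff_pos_left a
      rw [e1, e2]
      -- Of the `n - 2` remaining points, `⌊(n - 2)/2⌋` are on the left, so the right side has the
      -- same number or one more.
      have hcard : (Finset.univ.filter fun k => 0 < orient (p e.1) (p e.2) (p k)).card =
          (n - 2) / 2 := hcard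
      norm_cast
      omega
  have hcard : E.card ≤ 2 * (E.image g).card := by
    refine Finset.card_le_mul_card_image E 2 fun L hL => ?_
    obtain ⟨e, he, rfl⟩ := Finset.mem_image.1 hL
    refine (Finset.card_le_card (t := {(e.1, e.2), (e.2, e.1)}) ?_).trans Finset.card_le_two
    intro e' he'
    obtain ⟨he', hge⟩ := Finset.mem_filter.1 he'
    have a1 : ofCoords2 (p e'.1) ∈ g e := by rw [← hge]; exact (hmem e' _ he').2 (Or.inl rfl)
    have a2 : ofCoords2 (p e'.2) ∈ g e := by rw [← hge]; exact (hmem e' _ he').2 (Or.inr rfl)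
    have hne' := (mem_levelEdges.1 he').1
    simp only [Finset.mem_insert, Finset.mem_singleton]
    rcases (hmem e _ he).1 a1 with h1 | h1 <;> rcases (hmem e _ he).1 a2 with h2 | h2
    · exact absurd (h1.trans h2.symm) hne'
    · left; exact Prod.ext h1 h2
    · right; exact Prod.ext h1 h2
    · exact absurd (h1.trans h2.symm) hne'
  refine hcard.trans (Nat.mul_le_mul_left 2 ?_)
  have h3 : ((E.image g).card : ℕ∞) ≤ h₂ n := by
    rw [← Set.encard_coe_eq_coe_finsetCard]
    refine (Set.encard_le_encard ?_).trans
      (le_sSup ⟨P, hP, hp.generalPosition2, rfl⟩)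
    intro L hL
    obtain ⟨e, he, rfl⟩ := Finset.mem_image.1 (Finset.mem_coe.1 hL)
    exact hhalv e he
  rw [← ENat.natCast_toNat (h₂_ne_top n)] at h3
  exact_mod_cast h3

theorem mul_pos_left_of_neg {c x : ℝ} (hc : c < 0) : 0 < c * x ↔ x < 0 := by
  constructor <;> intro h <;> nlinarith

theorem mul_neg_left_of_neg {c x : ℝ} (hc : c < 0) : c * x < 0 ↔ 0 < x := by
  constructor <;> intro h <;> nlinarith

theorem mul_neg_left_of_pos {c x : ℝ} (hc : 0 < c) : c * x < 0 ↔ x < 0 := by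
  constructor <;> intro h <;> nlinarith

/-- The maximum number of halving lines is realized by the level edges of a configuration. -/
theorem exists_genPos_h₂_le (n : ℕ) :
    ∃ (ι : Type) (_ : Fintype ι) (p : ι → ℝ × ℝ), Fintype.card ι = n ∧ GenPos p ∧
      (h₂ n).toNat ≤ (levelEdges (chirotope p) ((n - 2) / 2)).card := by
  classical
  obtain ⟨P, hP, hgp, hh⟩ := (isGreatest_h₂ n).1
  have hPf := Set.finite_of_encard_eq_coe hP
  have : Fintype P := hPf.fintype
  obtain ⟨q, hq, hsign⟩ := exists_genPos_of_vectors
    (fun i : P => ![1, (i : Plane2) 0, (i : Plane2) 1]) (by simp)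
  have hdet : ∀ i j k : P, det3 ![1, (i : Plane2) 0, (i : Plane2) 1]
      ![1, (j : Plane2) 0, (j : Plane2) 1] ![1, (k : Plane2) 0, (k : Plane2) 1] =
      orient (coords2 i) (coords2 j) (coords2 k) := by
    intro i j k
    simp [det3, orient, coords2]; ring
  simp only [hdet] at hsign
  have hcardP : Fintype.card P = n := by
    rw [← Set.toFinset_card]
    rw [Set.encard_eq_coe_toFinset_card] at hP
    exact_mod_cast hP
  -- The perturbation preserves nonzero orientations. Zero orientations occur only for repeated
  -- indices, where they remain zero.
  have hpos : ∀ i j k : P, i ≠ j → (0 < orient (coords2 i) (coords2 j) (coords2 k) ↔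
      0 < orient (q i) (q j) (q k)) := by
    intro i j k hij
    refine ⟨(hsign i j k).1, fun h => ?_⟩
    rcases lt_trichotomy (orient (coords2 i) (coords2 j) (coords2 k)) 0 with h' | h' | h'
    · exact absurd ((hsign i j k).2 h') (not_lt.2 h.le)
    · exfalso
      have hc := collinear_of_orient_eq_zero (fun h => hij (Subtype.ext h)) h'
      have hk : k ≠ i ∧ k ≠ j := by
        constructor
        · rintro rfl; rw [orient_self_left] at h; exact lt_irrefl _ h
        · rintro rfl; rw [orient_self_right] at h; exact lt_irrefl _ h
      exact hgp i i.2 j j.2 k k.2 (fun h => hij (Subtype.ext h))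
        (fun h => hk.1 (Subtype.ext h.symm)) (fun h => hk.2 (Subtype.ext h.symm)) hc
    · exact h'
  refine ⟨P, inferInstance, q, hcardP, hq, ?_⟩
  set E := levelEdges (chirotope q) ((n - 2) / 2)
  have hsub : halvingLines P ⊆ (fun e : P × P =>
      {x | orient (coords2 e.1) (coords2 e.2) (coords2 x) = 0}) '' (E : Set (P × P)) := by
    rintro L ⟨v, a, hv, rfl, h2, h3, h4⟩
    obtain ⟨x, y, hxy, hPL⟩ := Set.encard_eq_two.1 h2
    have hx : x ∈ P ∩ line2 v a := by rw [hPL]; simp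
    have hy : y ∈ P ∩ line2 v a := by rw [hPL]; simp
    rw [encard_sep_eq, encard_sep_eq] at h3 h4
    have hxy' : (⟨x, hx.1⟩ : P) ≠ ⟨y, hy.1⟩ := fun h => hxy (congrArg Subtype.val h)
    generalize hi : (⟨x, hx.1⟩ : P) = i at hxy'
    generalize hj : (⟨y, hy.1⟩ : P) = j at hxy'
    have hxi : x = i := by rw [← hi]
    have hyj : y = j := by rw [← hj]
    obtain ⟨c, hc, hz⟩ := exists_orient_multiple hv hxy hx.2 hy.2
    rw [hxi, hyj] at hz
    have hneg : ∀ k : P, orient (coords2 i) (coords2 j) (coords2 k) < 0 ↔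
        orient (q i) (q j) (q k) < 0 := fun k => by
      have := hpos j i k hxy'.symm
      rwa [orient_swap, orient_swap (q i), neg_pos, neg_pos] at this
    have htot := hq.card_left_add_card_right hxy'
    have hline : ∀ z, orient (coords2 i) (coords2 j) (coords2 z) = 0 ↔ z ∈ line2 v a := fun z => by
      have := hz z
      simp only [line2, Set.mem_ofPred_eq]
      rw [← sub_eq_zero (b := a), this]
      simp [hc]
    -- For odd `n` only one direction of a halving line has the smaller side on its left; for even
    -- `n` both directions qualify.
    have hcounts : (Finset.univ.filter fun k => 0 < orient (q i) (q j) (q k)).card = (n - 2) / 2 ∨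
        (Finset.univ.filter fun k => orient (q i) (q j) (q k) < 0).card = (n - 2) / 2 := by
      simp only [← sub_pos (b := a), ← sub_neg (b := a), hz] at h3 h4
      norm_cast at h3 h4
      rcases lt_or_gt_of_ne hc with hc | hc
      · simp only [mul_pos_left_of_neg hc, mul_neg_left_of_neg hc, hneg] at h3 h4
        simp only [← hpos _ _ _ hxy'] at htot ⊢
        omega
      · simp only [mul_pos_iff_of_pos_left hc, mul_neg_left_of_pos hc, hneg] at h3 h4
        simp only [← hpos _ _ _ hxy'] at htot ⊢
        omega
    rcases hcounts with h | h
    · refine ⟨(i, j), mem_levelEdges.2 ⟨hxy', h⟩, ?_⟩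
      ext z
      exact hline z
    · refine ⟨(j, i), mem_levelEdges.2 ⟨hxy'.symm, ?_⟩, ?_⟩
      · simp only [chirotope, orient_swap (q i), neg_pos]
        exact h
      · ext z
        simp only [Set.mem_ofPred_eq, orient_swap (coords2 i), neg_eq_zero]
        exact hline z
  have h3 : h₂ n ≤ E.card := by
    rw [hh, ← Set.encard_coe_eq_coe_finsetCard]
    exact (Set.encard_le_encard hsub).trans (Set.encard_image_le _ _)
  rw [← ENat.natCast_toNat (h₂_ne_top n)] at h3
  exact_mod_cast h3

/-! ### Bounds for the number of level edges -/

/-- All configurations of at most `m` points have at most `C` edges at every level. -/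
def EdgeBound (m C : ℕ) : Prop :=
  ∀ (ι : Type) [Fintype ι] (p : ι → ℝ × ℝ), GenPos p → Fintype.card ι ≤ m →
    ∀ a, (levelEdges (chirotope p) a).card ≤ C

/-- A point far up is to the left of every edge directed rightwards, and a point far down is to its
right. Adding suitable numbers of both moves level `a` to the middle level of an `n`-point set. -/
theorem GenPos.card_levelEdges_left_to_right_le {ι : Type} [Fintype ι] {p : ι → ℝ × ℝ}
    (hp : GenPos p) {n : ℕ} (hn : 2 * Fintype.card ι ≤ n) (a : ℕ) :
    ((levelEdges (chirotope p) a).filter fun e => (p e.1).1 < (p e.2).1).card ≤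
      2 * (h₂ n).toNat := by
  classical
  rcases Finset.eq_empty_or_nonempty
    ((levelEdges (chirotope p) a).filter fun e => (p e.1).1 < (p e.2).1) with h | ⟨e, he⟩
  · simp [h]
  have ha : a + 2 ≤ Fintype.card ι := by
    obtain ⟨hne, hcard⟩ := mem_levelEdges.1 (Finset.mem_filter.1 he).1
    have hcard : (Finset.univ.filter fun k => 0 < orient (p e.1) (p e.2) (p k)).card = a := hcard
    have := hp.card_left_add_card_right hne
    omega
  -- There is room for this because `a + 2 ≤ card ι ≤ n / 2`.
  obtain ⟨u, hu⟩ : ∃ u, a + u = (n - 2) / 2 := ⟨(n - 2) / 2 - a, by omega⟩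
  obtain ⟨d, hd⟩ : ∃ d, Fintype.card ι + (u + d) = n := ⟨n - Fintype.card ι - u, by omega⟩
  -- Homogeneous coordinates: the new points have weight 0, in the directions up and down.
  let v : ι ⊕ (Fin u ⊕ Fin d) → Fin 3 → ℝ :=
    Sum.elim (fun i => ![1, (p i).1, (p i).2]) (Sum.elim (fun _ => ![0, 0, 1]) fun _ => ![0, 0, -1])
  obtain ⟨q, hq, hsign⟩ := exists_genPos_of_vectors v (by
    rintro (i | i | i) <;> simp [v])
  have hcardq : Fintype.card (ι ⊕ (Fin u ⊕ Fin d)) = n := by simp [hd]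
  have hle := hq.card_levelEdges_middle_le
  rw [hcardq] at hle
  refine le_trans ?_ hle
  refine Finset.card_le_card_of_injOn (fun e => (Sum.inl e.1, Sum.inl e.2)) ?_ ?_
  swap
  · rintro ⟨i, j⟩ - ⟨i', j'⟩ - h
    simpa using h
  rintro ⟨i, j⟩ he
  obtain ⟨he, hx⟩ := Finset.mem_filter.1 (Finset.mem_coe.1 he)
  obtain ⟨hne, hcard⟩ := mem_levelEdges.1 he
  dsimp only at hne hcard hx
  rw [Finset.mem_coe, mem_levelEdges]
  refine ⟨by simpa using hne, ?_⟩
  have h1 : ∀ k, 0 < chirotope q (Sum.inl i) (Sum.inl j) (Sum.inl k) ↔ 0 < chirotope p i j k := by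
    intro k
    have hdet : det3 (v (Sum.inl i)) (v (Sum.inl j)) (v (Sum.inl k)) = chirotope p i j k := by
      simp [v, det3, chirotope, orient]; ring
    have := hsign (Sum.inl i) (Sum.inl j) (Sum.inl k)
    rw [hdet] at this
    refine ⟨fun h => ?_, this.1⟩
    rcases lt_trichotomy (chirotope p i j k) 0 with h' | h' | h'
    · exact absurd (this.2 h') (not_lt.2 h.le)
    · rcases (hp.orient_eq_zero_iff hne).1 h' with rfl | rfl
      · exact absurd h (by simp [chirotope, orient_self_left])
      · exact absurd h (by simp [chirotope, orient_self_right])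
    · exact h'
  have h2 : ∀ k, 0 < chirotope q (Sum.inl i) (Sum.inl j) (Sum.inr (Sum.inl k)) := by
    intro k
    apply (hsign _ _ _).1
    simp [v, det3]; linarith
  have h3 : ∀ k, ¬ 0 < chirotope q (Sum.inl i) (Sum.inl j) (Sum.inr (Sum.inr k)) := by
    intro k
    refine not_lt.2 (le_of_lt ((hsign _ _ _).2 ?_))
    simp [v, det3]; linarith
  change (Finset.univ.filter fun k => 0 < chirotope q (Sum.inl i) (Sum.inl j) k).card = _
  rw [← hu, ← hcard, Finset.card_filter, Finset.card_filter, Fintype.sum_sum_type,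
    Fintype.sum_sum_type]
  simp [h1, h2, h3]

theorem GenPos.neg {ι : Type*} {p : ι → ℝ × ℝ} (hp : GenPos p) : GenPos fun i => -p i := by
  refine ⟨fun i j h => hp.fst_injective (by simpa using h), fun i j k hij hik hjk => ?_⟩
  have : orient (-p i) (-p j) (-p k) = orient (p i) (p j) (p k) := by simp [orient]; ring
  rw [this]
  exact hp.orient_ne_zero i j k hij hik hjk

/-- The reflection `p ↦ -p` preserves all orientations and exchanges the edges directed rightwards
and leftwards, so each kind contributes at most `2 h₂ n`. -/
theorem edgeBound_of_two_mul_le {m n : ℕ} (h : 2 * m ≤ n) : EdgeBound m (4 * (h₂ n).toNat) := by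
  classical
  intro ι _ p hp hm a
  have h1 := hp.card_levelEdges_left_to_right_le (n := n) (by omega) a
  have h2 := hp.neg.card_levelEdges_left_to_right_le (n := n) (by omega) a
  rw [levelEdges_congr (D' := chirotope p)] at h2
  swap
  · intro i j k
    have : chirotope (fun i => -p i) i j k = chirotope p i j k := by
      simp [chirotope, orient]; ring
    rw [this]
  rw [← Finset.card_filter_add_card_filter_not (fun e => (p e.1).1 < (p e.2).1)]
  have h3 : ((levelEdges (chirotope p) a).filter fun e => ¬ (p e.1).1 < (p e.2).1).card ≤
      2 * (h₂ n).toNat := by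
    refine le_trans (Finset.card_le_card fun e he => ?_) h2
    obtain ⟨he, hx⟩ := Finset.mem_filter.1 he
    refine Finset.mem_filter.2 ⟨he, ?_⟩
    have hne : (p e.1).1 ≠ (p e.2).1 := fun h => (mem_levelEdges.1 he).1 (hp.fst_injective h)
    simpa using lt_of_le_of_ne (not_lt.1 hx) hne.symm
  omega

/-- Deleting `Q` lowers the number of points on the left by `Q.card` if `Q` is on the left of the
edge and leaves it unchanged if `Q` is on the right. In either case all edges of `S` survive on one
common level of at most `m` points. -/
theorem EdgeBound.card_le_of_same_side {m C : ℕ} (hC : EdgeBound m C) {ι : Type} [Fintype ι]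
    {p : ι → ℝ × ℝ} (hp : GenPos p) (a : ℕ) (Q : Finset ι) (hQ : Fintype.card ι ≤ m + Q.card) :
    (∀ S ⊆ levelEdges (chirotope p) a,
      (∀ e ∈ S, ∀ k ∈ Q, 0 < orient (p e.1) (p e.2) (p k)) → S.card ≤ C) ∧
    ∀ S ⊆ levelEdges (chirotope p) a,
      (∀ e ∈ S, ∀ k ∈ Q, orient (p e.1) (p e.2) (p k) < 0) → S.card ≤ C := by
  classical
  let p' : {k // k ∉ Q} → ℝ × ℝ := fun k => p k
  have hp' : GenPos p' := ⟨fun i j h => Subtype.ext (hp.fst_injective h), fun i j k hij hik hjk =>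
    hp.orient_ne_zero _ _ _ (fun h => hij (Subtype.ext h)) (fun h => hik (Subtype.ext h))
      fun h => hjk (Subtype.ext h)⟩
  have hcard : Fintype.card {k // k ∉ Q} ≤ m := by
    rw [Fintype.card_subtype_compl, Fintype.card_coe]
    omega
  have key : ∀ (S : Finset (ι × ι)) (b : ℕ), (∀ e ∈ S, e.1 ≠ e.2 ∧ e.1 ∉ Q ∧ e.2 ∉ Q ∧
      ((Finset.univ.filter fun k => 0 < orient (p e.1) (p e.2) (p k)) \ Q).card = b) →
      S.card ≤ C := by
    intro S b hS
    refine le_trans ?_ (hC _ p' hp' hcard b)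
    refine (Finset.card_le_card (t := (levelEdges (chirotope p') b).image
      (Prod.map Subtype.val Subtype.val)) ?_).trans Finset.card_image_le
    intro e he
    obtain ⟨hne, h1, h2, hc⟩ := hS e he
    refine Finset.mem_image.2 ⟨(⟨e.1, h1⟩, ⟨e.2, h2⟩), mem_levelEdges.2 ⟨?_, ?_⟩, rfl⟩
    · exact fun h => hne (congrArg Subtype.val h)
    · rw [← hc, ← Finset.card_map (Function.Embedding.subtype _)]
      congr 1
      ext k
      simp only [Finset.mem_map, Finset.mem_filter, Finset.mem_univ, true_and, Finset.mem_sdiff,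
        Function.Embedding.subtype_apply]
      constructor
      · rintro ⟨x, h, rfl⟩; exact ⟨h, x.2⟩
      · rintro ⟨h, hk⟩; exact ⟨⟨k, hk⟩, h, rfl⟩
  constructor
  · intro S hS hpos
    apply key _ (a - Q.card)
    intro e he
    have hpos := hpos e he
    obtain ⟨hne, hc⟩ := mem_levelEdges.1 (hS he)
    refine ⟨hne, fun h => ?_, fun h => ?_, ?_⟩
    · have := hpos _ h; rw [orient_self_left] at this; exact lt_irrefl _ this
    · have := hpos _ h; rw [orient_self_right] at this; exact lt_irrefl _ this
    · rw [Finset.card_sdiff_of_subset fun k hk => by simpa using hpos k hk]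
      congr 1
  · intro S hS hneg
    apply key _ a
    intro e he
    have hneg := hneg e he
    obtain ⟨hne, hc⟩ := mem_levelEdges.1 (hS he)
    refine ⟨hne, fun h => ?_, fun h => ?_, ?_⟩
    · have := hneg _ h; rw [orient_self_left] at this; exact lt_irrefl _ this
    · have := hneg _ h; rw [orient_self_right] at this; exact lt_irrefl _ this
    · rw [Finset.sdiff_eq_self_of_disjoint]
      · exact hc
      · rw [Finset.disjoint_left]
        intro k hk hkQ
        have := hneg k hkQ
        have h' := (Finset.mem_filter.1 hk).2
        linarith

/-! ### Cutting a planar set into four parts -/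

/-- The `k`-th smallest value of a family is a continuous function of the family. -/
theorem exists_orderStatistic {ι : Type*} [Fintype ι] (L : Finset ι) {k : ℕ} (hk : 0 < k)
    (hkL : k ≤ L.card) : ∃ φ : (ι → ℝ) → ℝ, Continuous φ ∧
      ∀ g, k ≤ (L.filter fun i => g i ≤ φ g).card ∧ (L.filter fun i => g i < φ g).card < k := by
  classical
  have hne : (L.powersetCard k).attach.Nonempty := by
    rw [Finset.attach_nonempty_iff]; exact Finset.powersetCard_nonempty.2 hkL
  have hT : ∀ T : {T // T ∈ L.powersetCard k}, T.1.Nonempty := fun T => by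
    rw [← Finset.card_pos, (Finset.mem_powersetCard.1 T.2).2]; exact hk
  -- The `k`-th smallest value is the minimum, over all `k`-subsets, of the maximum on the subset,
  -- which makes continuity evident.
  refine ⟨fun g => (L.powersetCard k).attach.inf' hne fun T => T.1.sup' (hT T) g, ?_, fun g => ?_⟩
  · refine Continuous.finset_inf'_apply hne fun T _ => ?_
    exact Continuous.finset_sup'_apply (hT T) fun i _ => continuous_apply i
  · constructor
    · obtain ⟨T, -, hTe⟩ := Finset.exists_mem_eq_inf' hne fun T => T.1.sup' (hT T) g
      refine (Finset.mem_powersetCard.1 T.2).2.symm.le.trans ?_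
      refine Finset.card_le_card fun i hi => Finset.mem_filter.2
        ⟨(Finset.mem_powersetCard.1 T.2).1 hi, ?_⟩
      dsimp only
      rw [hTe]
      exact Finset.le_sup' g hi
    · by_contra! h
      obtain ⟨T, hTs, hTc⟩ := Finset.exists_subset_card_eq h
      have hTm : T ∈ L.powersetCard k :=
        Finset.mem_powersetCard.2 ⟨hTs.trans (Finset.filter_subset _ _), hTc⟩
      have h1 := Finset.inf'_le (fun T : {T // T ∈ L.powersetCard k} => T.1.sup' (hT T) g)
        (Finset.mem_attach _ ⟨T, hTm⟩)
      obtain ⟨i, hi, hie⟩ := Finset.exists_mem_eq_sup' (hT ⟨T, hTm⟩) g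
      have h2 := (Finset.mem_filter.1 (hTs hi)).2
      dsimp only at h1 h2 hie
      rw [hie] at h1
      exact absurd h2 (not_lt.2 h1)

theorem card_filter_trichotomy {ι : Type*} (L : Finset ι) (g : ι → ℝ) (c : ℝ) :
    (L.filter fun i => g i < c).card + (L.filter fun i => g i = c).card +
      (L.filter fun i => c < g i).card = L.card ∧
    (L.filter fun i => g i ≤ c).card =
      (L.filter fun i => g i < c).card + (L.filter fun i => g i = c).card := by
  classical
  have h : (L.filter fun i => g i ≤ c).card =
      (L.filter fun i => g i < c).card + (L.filter fun i => g i = c).card := by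
    rw [← Finset.card_union_of_disjoint]
    · congr 1
      ext i
      simp only [Finset.mem_filter, Finset.mem_union, le_iff_lt_or_eq]
      tauto
    · rw [Finset.disjoint_left]
      intro i h1 h2
      exact (Finset.mem_filter.1 h1).2.ne (Finset.mem_filter.1 h2).2
  refine ⟨?_, h⟩
  rw [← h, ← Finset.card_filter_add_card_filter_not (s := L) (fun i => g i ≤ c)]
  simp only [not_le]

/-- For very steep directions the heights `y - s x` are ordered by the first coordinate alone. This
provides the two ends for an intermediate value argument. -/
theorem exists_slope_separating {ι : Type*} [Finite ι] (x y : ι → ℝ) :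
    (∃ s : ℝ, ∀ l r, x l < x r → y r - s * x r < y l - s * x l) ∧
      ∃ s : ℝ, ∀ l r, x l < x r → y l - s * x l < y r - s * x r := by
  constructor
  · have : ∀ᶠ s : ℝ in atTop, ∀ l r, x l < x r → y r - s * x r < y l - s * x l := by
      simp only [eventually_all]
      intro l r h
      filter_upwards [eventually_gt_atTop ((y r - y l) / (x r - x l))] with s hs
      rw [div_lt_iff₀ (sub_pos.2 h)] at hs
      linarith
    exact this.exists
  · have : ∀ᶠ s : ℝ in atBot, ∀ l r, x l < x r → y l - s * x l < y r - s * x r := by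
      simp only [eventually_all]
      intro l r h
      filter_upwards [eventually_lt_atBot ((y r - y l) / (x r - x l))] with s hs
      rw [lt_div_iff₀ (sub_pos.2 h)] at hs
      linarith
    exact this.exists

/-- Two crossing lines that cut a configuration into four parts of almost the same size; no line
meets all four parts. -/
theorem GenPos.exists_four_parts {ι : Type*} [Fintype ι] {p : ι → ℝ × ℝ} (hp : GenPos p) :
    ∃ Q : Fin 4 → Finset ι, (∀ c, Fintype.card ι ≤ 4 * (Q c).card + 12) ∧
      ∀ i j, i ≠ j → ∃ c, (∀ k ∈ Q c, 0 < orient (p i) (p j) (p k)) ∨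
        ∀ k ∈ Q c, orient (p i) (p j) (p k) < 0 := by
  classical
  by_cases hN : Fintype.card ι ≤ 12
  · exact ⟨fun _ => ∅, fun c => by simpa using hN, fun i j _ => ⟨0, by simp⟩⟩
  set N := Fintype.card ι with hNdef
  -- The first cutting line is the vertical line through a median point; first coordinates are
  -- distinct, so it contains at most one point.
  obtain ⟨φ, -, hφ⟩ := exists_orderStatistic (Finset.univ : Finset ι) (k := N / 2 + 1) (by omega)
    (by rw [Finset.card_univ]; omega)
  obtain ⟨hφ1, hφ2⟩ := hφ fun i => (p i).1
  set x₀ := φ fun i => (p i).1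
  set L := Finset.univ.filter fun i => (p i).1 < x₀ with hL
  set R := Finset.univ.filter fun i => x₀ < (p i).1 with hR
  obtain ⟨hc1, hc2⟩ := card_filter_trichotomy (Finset.univ : Finset ι) (fun i => (p i).1) x₀
  have heq : (Finset.univ.filter fun i => (p i).1 = x₀).card ≤ 1 := by
    rw [Finset.card_le_one]
    intro i hi j hj
    exact hp.fst_injective ((Finset.mem_filter.1 hi).2.trans (Finset.mem_filter.1 hj).2.symm)
  rw [Finset.card_univ] at hc1
  have hc1 : L.card + (Finset.univ.filter fun i => (p i).1 = x₀).card + R.card = N := hc1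
  have hc2 : _ = L.card + (Finset.univ.filter fun i => (p i).1 = x₀).card := hc2
  have hLc : L.card = N / 2 := by omega
  have hRc : N / 2 + R.card + 1 ≥ N := by omega
  obtain ⟨φL, hLcont, hφL⟩ := exists_orderStatistic L (k := (L.card + 1) / 2) (by omega) (by omega)
  obtain ⟨φR, hRcont, hφR⟩ := exists_orderStatistic R (k := (R.card + 1) / 2) (by omega) (by omega)
  let G : ℝ → ι → ℝ := fun s i => (p i).2 - s * (p i).1
  have hG : Continuous G := by
    refine continuous_pi fun i => ?_
    simp only [G]
    fun_prop
  have witness : ∀ s, (∃ i ∈ L, φL (G s) ≤ G s i) ∧ (∃ i ∈ L, G s i ≤ φL (G s)) ∧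
      (∃ i ∈ R, φR (G s) ≤ G s i) ∧ ∃ i ∈ R, G s i ≤ φR (G s) := by
    intro s
    obtain ⟨a1, a2⟩ := hφL (G s)
    obtain ⟨b1, b2⟩ := hφR (G s)
    obtain ⟨c1, c2⟩ := card_filter_trichotomy L (G s) (φL (G s))
    obtain ⟨d1, d2⟩ := card_filter_trichotomy R (G s) (φR (G s))
    have e1 : ∃ i ∈ L, φL (G s) ≤ G s i := by
      by_contra! h
      rw [Finset.filter_true_of_mem h] at a2
      omega
    have e2 : ∃ i ∈ R, φR (G s) ≤ G s i := by
      by_contra! h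
      rw [Finset.filter_true_of_mem h] at b2
      omega
    have e3 : ∃ i ∈ L, G s i ≤ φL (G s) := by
      obtain ⟨i, hi⟩ := Finset.card_pos.1 (lt_of_lt_of_le (by omega) a1)
      exact ⟨i, (Finset.mem_filter.1 hi).1, (Finset.mem_filter.1 hi).2⟩
    have e4 : ∃ i ∈ R, G s i ≤ φR (G s) := by
      obtain ⟨i, hi⟩ := Finset.card_pos.1 (lt_of_lt_of_le (by omega) b1)
      exact ⟨i, (Finset.mem_filter.1 hi).1, (Finset.mem_filter.1 hi).2⟩
    exact ⟨e1, e3, e2, e4⟩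
  have hLR : ∀ l ∈ L, ∀ r ∈ R, (p l).1 < (p r).1 := fun l hl r hr =>
    (Finset.mem_filter.1 hl).2.trans (Finset.mem_filter.1 hr).2
  obtain ⟨⟨s₁, hs₁⟩, s₂, hs₂⟩ := exists_slope_separating (fun i => (p i).1) fun i => (p i).2
  -- Ham-sandwich by the intermediate value theorem: at some slope the median heights of the left
  -- and the right half agree, so one line of that slope bisects both.
  have hF : Continuous fun s => φL (G s) - φR (G s) := by fun_prop
  obtain ⟨s, hs⟩ : (0 : ℝ) ∈ Set.range fun s => φL (G s) - φR (G s) := by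
    refine mem_range_of_exists_le_of_exists_ge hF ⟨s₂, ?_⟩ ⟨s₁, ?_⟩
    · obtain ⟨⟨l, hl, hl'⟩, -, -, r, hr, hr'⟩ := witness s₂
      have := hs₂ l r (hLR l hl r hr)
      simp only [G] at hl' hr' ⊢
      linarith
    · obtain ⟨-, ⟨l, hl, hl'⟩, ⟨r, hr, hr'⟩, -⟩ := witness s₁
      have := hs₁ l r (hLR l hl r hr)
      simp only [G] at hl' hr' ⊢
      linarith
  have hs : φR (G s) = φL (G s) := by simp only at hs; linarith
  set c := φL (G s) with hcdef
  have hline : (Finset.univ.filter fun i => G s i = c).card ≤ 2 := by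
    by_contra! h
    obtain ⟨i, hi, j, hj, k, hk, hij, hik, hjk⟩ := Finset.two_lt_card.1 h
    simp only [Finset.mem_filter, Finset.mem_univ, true_and, G] at hi hj hk
    apply hp.orient_ne_zero i j k hij hik hjk
    have hi : (p i).2 = c + s * (p i).1 := by linarith
    have hj : (p j).2 = c + s * (p j).1 := by linarith
    have hk : (p k).2 = c + s * (p k).1 := by linarith
    simp only [orient, hi, hj, hk]
    ring
  have hlineL : (L.filter fun i => G s i = c).card ≤ 2 :=
    (Finset.card_le_card (Finset.filter_subset_filter _ (Finset.subset_univ _))).trans hline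
  have hlineR : (R.filter fun i => G s i = c).card ≤ 2 :=
    (Finset.card_le_card (Finset.filter_subset_filter _ (Finset.subset_univ _))).trans hline
  obtain ⟨a1, a2⟩ := hφL (G s)
  obtain ⟨b1, b2⟩ := hφR (G s)
  rw [hs] at b1 b2
  obtain ⟨c1, c2⟩ := card_filter_trichotomy L (G s) c
  obtain ⟨d1, d2⟩ := card_filter_trichotomy R (G s) c
  rw [← hcdef] at a1 a2
  -- The parts are the open quadrants, in the order lower right, lower left, upper left, upper
  -- right. The slack 12 absorbs rounding and the points on the cutting lines.
  refine ⟨![R.filter fun i => G s i < c, L.filter fun i => G s i < c,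
    L.filter fun i => c < G s i, R.filter fun i => c < G s i], ?_, ?_⟩
  · intro t
    fin_cases t
    · change N ≤ 4 * (R.filter fun i => G s i < c).card + 12; omega
    · change N ≤ 4 * (L.filter fun i => G s i < c).card + 12; omega
    · change N ≤ 4 * (L.filter fun i => c < G s i).card + 12; omega
    · change N ≤ 4 * (R.filter fun i => c < G s i).card + 12; omega
  · intro i j hij
    have hD : (p j).1 - (p i).1 ≠ 0 := sub_ne_zero.2 fun h => hij (hp.fst_injective h.symm)
    obtain ⟨m, hm⟩ : ∃ m, (p j).2 - (p i).2 = m * ((p j).1 - (p i).1) :=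
      ⟨((p j).2 - (p i).2) / ((p j).1 - (p i).1), by field_simp⟩
    set α := m - s with hα
    -- Relative to the second cutting line, the line through `p i` and `p j` has height `β` at `x₀`
    -- and slope `α`. The signs of `α` and `β` name the missed quadrant.
    set β := (p i).2 + m * (x₀ - (p i).1) - (s * x₀ + c) with hβ
    have horient : ∀ k, orient (p i) (p j) (p k) =
        ((p j).1 - (p i).1) * ((G s k - c) - (β + α * ((p k).1 - x₀))) := by
      intro k
      simp only [orient, hm, G, hα, hβ]
      ring
    have below : ∀ Q : Finset ι, (∀ k ∈ Q, (G s k - c) - (β + α * ((p k).1 - x₀)) < 0) →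
        (∀ k ∈ Q, 0 < orient (p i) (p j) (p k)) ∨ ∀ k ∈ Q, orient (p i) (p j) (p k) < 0 := by
      intro Q hQ
      simp only [horient]
      rcases lt_or_gt_of_ne hD with h | h
      · exact Or.inl fun k hk => mul_pos_of_neg_of_neg h (hQ k hk)
      · exact Or.inr fun k hk => mul_neg_of_pos_of_neg h (hQ k hk)
    have above : ∀ Q : Finset ι, (∀ k ∈ Q, 0 < (G s k - c) - (β + α * ((p k).1 - x₀))) →
        (∀ k ∈ Q, 0 < orient (p i) (p j) (p k)) ∨ ∀ k ∈ Q, orient (p i) (p j) (p k) < 0 := by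
      intro Q hQ
      simp only [horient]
      rcases lt_or_gt_of_ne hD with h | h
      · exact Or.inr fun k hk => mul_neg_of_neg_of_pos h (hQ k hk)
      · exact Or.inl fun k hk => mul_pos h (hQ k hk)
    rcases le_total 0 β with hb | hb <;> rcases le_total 0 α with hα' | hα'
    · refine ⟨0, below _ fun k hk => ?_⟩
      obtain ⟨hk, hk2⟩ := Finset.mem_filter.1 (show k ∈ R.filter fun i => G s i < c from hk)
      have := mul_nonneg hα' (sub_nonneg.2 (Finset.mem_filter.1 hk).2.le)
      linarith
    · refine ⟨1, below _ fun k hk => ?_⟩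
      obtain ⟨hk, hk2⟩ := Finset.mem_filter.1 (show k ∈ L.filter fun i => G s i < c from hk)
      have := mul_nonneg_of_nonpos_of_nonpos hα' (sub_nonpos.2 (Finset.mem_filter.1 hk).2.le)
      linarith
    · refine ⟨2, above _ fun k hk => ?_⟩
      obtain ⟨hk, hk2⟩ := Finset.mem_filter.1 (show k ∈ L.filter fun i => c < G s i from hk)
      have := mul_nonpos_of_nonneg_of_nonpos hα' (sub_nonpos.2 (Finset.mem_filter.1 hk).2.le)
      linarith
    · refine ⟨3, above _ fun k hk => ?_⟩
      obtain ⟨hk, hk2⟩ := Finset.mem_filter.1 (show k ∈ R.filter fun i => c < G s i from hk)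
      have := mul_nonpos_of_nonpos_of_nonneg hα' (sub_nonneg.2 (Finset.mem_filter.1 hk).2.le)
      linarith

/-- Every edge misses one of four parts, each containing about a quarter of the points. The factor 8
counts the choices of the missed part and of the side of the edge on which it lies. -/
theorem EdgeBound.enlarge {m m' C : ℕ} (hC : EdgeBound m C) (hm : 3 * m' + 12 ≤ 4 * m) :
    EdgeBound m' (8 * C) := by
  classical
  intro ι _ p hp hcard a
  obtain ⟨Q, hQ, hE⟩ := hp.exists_four_parts
  set E := levelEdges (chirotope p) a
  have hsub : E ⊆ Finset.univ.biUnion fun c =>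
      (E.filter fun e => ∀ k ∈ Q c, 0 < orient (p e.1) (p e.2) (p k)) ∪
        E.filter fun e => ∀ k ∈ Q c, orient (p e.1) (p e.2) (p k) < 0 := by
    intro e he
    obtain ⟨c, hc⟩ := hE e.1 e.2 (mem_levelEdges.1 he).1
    refine Finset.mem_biUnion.2 ⟨c, Finset.mem_univ _, Finset.mem_union.2 ?_⟩
    exact hc.imp (fun h => Finset.mem_filter.2 ⟨he, h⟩) fun h => Finset.mem_filter.2 ⟨he, h⟩
  refine (Finset.card_le_card hsub).trans ((Finset.card_biUnion_le_card_mul _ _ (2 * C) ?_).trans ?_)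
  · intro c _
    have h1 := hQ c
    have h2 := hC.card_le_of_same_side hp a (Q c) (by omega)
    refine (Finset.card_union_le _ _).trans ((add_le_add (h2.1 _ (Finset.filter_subset _ _) ?_)
      (h2.2 _ (Finset.filter_subset _ _) ?_)).trans (two_mul C).ge)
    · intro e he; exact (Finset.mem_filter.1 he).2
    · intro e he; exact (Finset.mem_filter.1 he).2
  · rw [Finset.card_univ, Fintype.card_fin]
    omega

/-- Seven enlargements suffice, since `(1/2)(4/3)^7 > 3`; the bound `1000 ≤ m` pays for the additive
losses. The constant is `4 · 8^7 ≤ 8^8`. -/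
theorem edgeBound_of_le_three_mul {n m : ℕ} (h : n ≤ 3 * m) (hm : 1000 ≤ m) :
    EdgeBound n (8 ^ 8 * (h₂ m).toNat) := by
  have h0 : EdgeBound (m / 2) (4 * (h₂ m).toNat) := edgeBound_of_two_mul_le (by omega)
  have h1 := h0.enlarge (m' := (4 * (m / 2) - 12) / 3) (by omega)
  have h2 := h1.enlarge (m' := (4 * ((4 * (m / 2) - 12) / 3) - 12) / 3) (by omega)
  generalize hk2 : (4 * ((4 * (m / 2) - 12) / 3) - 12) / 3 = k2 at h2
  have h3 := h2.enlarge (m' := (4 * k2 - 12) / 3) (by omega)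
  generalize hk3 : (4 * k2 - 12) / 3 = k3 at h3
  have h4 := h3.enlarge (m' := (4 * k3 - 12) / 3) (by omega)
  generalize hk4 : (4 * k3 - 12) / 3 = k4 at h4
  have h5 := h4.enlarge (m' := (4 * k4 - 12) / 3) (by omega)
  generalize hk5 : (4 * k4 - 12) / 3 = k5 at h5
  have h6 := h5.enlarge (m' := (4 * k5 - 12) / 3) (by omega)
  generalize hk6 : (4 * k5 - 12) / 3 = k6 at h6
  have h7 := h6.enlarge (m' := (4 * k6 - 12) / 3) (by omega)
  intro ι _ p hp hc a
  refine (h7 ι p hp (by omega) a).trans ?_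
  omega

/-! ### Heights above planes -/

/-- The signed vertical distance of `x` from the plane dual to `p`. -/
def height (p x : Space3) : ℝ := x 2 - (p 0 * x 0 + p 1 * x 1 - p 2)

/-- The linear part of `height`. -/
def climb (p d : Space3) : ℝ := d 2 - (p 0 * d 0 + p 1 * d 1)

theorem height_add_smul (p x d : Space3) (t : ℝ) :
    height p (x + t • d) = height p x + t * climb p d := by
  simp [height, climb]; ring

theorem continuous_height (p : Space3) : Continuous (height p) := by
  unfold height; fun_prop

theorem mem_dualPlane {p x : Space3} : x ∈ dualPlane p ↔ height p x = 0 := by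
  simp [dualPlane, height, sub_eq_zero]

theorem passesBelow_dualPlane {p x : Space3} : PassesBelow (dualPlane p) x ↔ 0 < height p x := by
  constructor
  · rintro ⟨y, hy, h0, h1, h2⟩
    rw [mem_dualPlane] at hy
    simp only [height, h0, h1] at hy ⊢
    linarith
  · intro h
    refine ⟨!₂[x 0, x 1, p 0 * x 0 + p 1 * x 1 - p 2], ?_, by simp, by simp, ?_⟩
    · simp [mem_dualPlane, height]
    · simp only [height] at h
      simp; linarith

theorem inner_space3 (v x : Space3) : inner ℝ v x = v 0 * x 0 + v 1 * x 1 + v 2 * x 2 := by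
  simp [PiLp.inner_apply, Fin.sum_univ_three, mul_comm]

theorem isNonverticalPlane_iff {S : Set Space3} : IsNonverticalPlane S ↔ ∃ p, S = dualPlane p := by
  constructor
  · rintro ⟨v, a, hv, rfl⟩
    refine ⟨!₂[-(v 0) / v 2, -(v 1) / v 2, -a / v 2], ?_⟩
    ext x
    simp only [plane3, mem_dualPlane, Set.mem_ofPred_eq, inner_space3, height]
    simp
    field_simp
    constructor <;> intro h <;> linarith
  · rintro ⟨p, rfl⟩
    refine ⟨!₂[-(p 0), -(p 1), 1], -(p 2), by simp, ?_⟩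
    ext x
    simp only [plane3, mem_dualPlane, Set.mem_ofPred_eq, inner_space3, height]
    simp
    constructor <;> intro h <;> linarith

theorem dualPlane_injective : Function.Injective dualPlane := by
  intro p q h
  have key : ∀ a b : ℝ, p 0 * a + p 1 * b - p 2 = q 0 * a + q 1 * b - q 2 := by
    intro a b
    have h1 : (!₂[a, b, p 0 * a + p 1 * b - p 2] : Space3) ∈ dualPlane p := by
      simp [mem_dualPlane, height]
    rw [h, mem_dualPlane] at h1
    simp [height] at h1
    linarith
  have h0 := key 0 0
  have h1 := key 1 0
  have h2 := key 0 1
  ext i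
  fin_cases i
  · simp; linarith
  · simp; linarith
  · simp; linarith

/-- A point dual to the non-vertical plane `S`. -/
noncomputable def dualPoint (S : Set Space3) : Space3 :=
  open Classical in if h : ∃ p, S = dualPlane p then h.choose else 0

theorem IsNonverticalPlane.dualPlane_dualPoint {S : Set Space3} (h : IsNonverticalPlane S) :
    dualPlane (dualPoint S) = S := by
  have h' := isNonverticalPlane_iff.1 h
  rw [dualPoint, dif_pos h']
  exact h'.choose_spec.symm

theorem dualPoint_dualPlane (p : Space3) : dualPoint (dualPlane p) = p :=
  dualPlane_injective (isNonverticalPlane_iff.2 ⟨p, rfl⟩).dualPlane_dualPoint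

theorem IsNonverticalPlane.mem_iff {S : Set Space3} (h : IsNonverticalPlane S) {x : Space3} :
    x ∈ S ↔ height (dualPoint S) x = 0 := by
  rw [← mem_dualPlane, h.dualPlane_dualPoint]

theorem IsNonverticalPlane.passesBelow_iff {S : Set Space3} (h : IsNonverticalPlane S)
    {x : Space3} : PassesBelow S x ↔ 0 < height (dualPoint S) x := by
  rw [← passesBelow_dualPlane, h.dualPlane_dualPoint]

/-! ### General position -/

theorem GeneralPosition3.mono {H H' : Set (Set Space3)} (hH : GeneralPosition3 H) (h : H' ⊆ H) :
    GeneralPosition3 H' :=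
  ⟨fun S hS => hH.1 S (h hS), fun S₁ h₁ S₂ h₂ S₃ h₃ => hH.2.1 S₁ (h h₁) S₂ (h h₂) S₃ (h h₃),
    fun x => (Set.encard_le_encard (t := {S ∈ H | x ∈ S}) fun _ hS =>
      ⟨h hS.1, hS.2⟩).trans (hH.2.2 x)⟩

/-- Three distinct planes of `H` meet at `x`. -/
def IsVertex (H : Set (Set Space3)) (x : Space3) : Prop :=
  ∃ S₁ ∈ H, ∃ S₂ ∈ H, ∃ S₃ ∈ H, S₁ ≠ S₂ ∧ S₁ ≠ S₃ ∧ S₂ ≠ S₃ ∧ x ∈ S₁ ∧ x ∈ S₂ ∧ x ∈ S₃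

theorem GeneralPosition3.eq_of_mem {H : Set (Set Space3)} (hH : GeneralPosition3 H)
    {S₁ S₂ S₃ : Set Space3} (h₁ : S₁ ∈ H) (h₂ : S₂ ∈ H) (h₃ : S₃ ∈ H) (h₁₂ : S₁ ≠ S₂)
    (h₁₃ : S₁ ≠ S₃) (h₂₃ : S₂ ≠ S₃) {x y : Space3} (hx : x ∈ S₁ ∧ x ∈ S₂ ∧ x ∈ S₃)
    (hy : y ∈ S₁ ∧ y ∈ S₂ ∧ y ∈ S₃) : x = y :=
  (hH.2.1 S₁ h₁ S₂ h₂ S₃ h₃ h₁₂ h₁₃ h₂₃).unique hx hy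

theorem GeneralPosition3.mem_triple {H : Set (Set Space3)} (hH : GeneralPosition3 H)
    {S₁ S₂ S₃ S : Set Space3} (h₁ : S₁ ∈ H) (h₂ : S₂ ∈ H) (h₃ : S₃ ∈ H) (h₁₂ : S₁ ≠ S₂)
    (h₁₃ : S₁ ≠ S₃) (h₂₃ : S₂ ≠ S₃) {x : Space3} (hx : x ∈ S₁ ∧ x ∈ S₂ ∧ x ∈ S₃)
    (hS : S ∈ H) (hxS : x ∈ S) : S = S₁ ∨ S = S₂ ∨ S = S₃ := by
  have hsub : ({S₁, S₂, S₃} : Set (Set Space3)) ⊆ {S ∈ H | x ∈ S} := by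
    rintro T (rfl | rfl | rfl)
    · exact ⟨h₁, hx.1⟩
    · exact ⟨h₂, hx.2.1⟩
    · exact ⟨h₃, hx.2.2⟩
  have h3 : ({S₁, S₂, S₃} : Set (Set Space3)).encard = 3 :=
    Set.encard_eq_three.2 ⟨S₁, S₂, S₃, h₁₂, h₁₃, h₂₃, rfl⟩
  have heq := (Set.toFinite ({S₁, S₂, S₃} : Set (Set Space3))).eq_of_subset_of_encard_le hsub (by rw [h3]; exact hH.2.2 x)
  have : S ∈ ({S₁, S₂, S₃} : Set (Set Space3)) := by rw [heq]; exact ⟨hS, hxS⟩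
  simpa using this

/-- Twice the signed area of the projection of the triangle `p q r` to the `xy`-plane. -/
def shadow (p q r : Space3) : ℝ := (q 0 - p 0) * (r 1 - p 1) - (q 1 - p 1) * (r 0 - p 0)

/-- Six times the signed volume of a tetrahedron. -/
def volume4 (p q r s : Space3) : ℝ :=
  det3 (fun i => q i - p i) (fun i => r i - p i) fun i => s i - p i

/-- By duality `p`, `q`, `r` lie on the plane dual to `x`, and `height s x` is the vertical distance
of `s` from that plane: the volume is base area times height. -/
theorem volume4_eq_shadow_mul_height {p q r x : Space3} (hp : height p x = 0)
    (hq : height q x = 0) (hr : height r x = 0) (s : Space3) :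
    volume4 p q r s = shadow p q r * height s x := by
  simp only [height] at hp hq hr
  have hp' : x 2 = p 0 * x 0 + p 1 * x 1 - p 2 := by linarith
  have hq' : q 2 = p 2 + (q 0 - p 0) * x 0 + (q 1 - p 1) * x 1 := by linarith
  have hr' : r 2 = p 2 + (r 0 - p 0) * x 0 + (r 1 - p 1) * x 1 := by linarith
  simp only [volume4, det3, shadow, height, hp', hq', hr']
  ring

/-- If the gradients of three planes are collinear, some horizontal direction is orthogonal to their
differences. Its lift to one of the planes is parallel to all three. -/
theorem exists_climb_eq_zero_of_shadow {p q r : Space3} (h : shadow p q r = 0) :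
    ∃ d : Space3, d ≠ 0 ∧ climb p d = 0 ∧ climb q d = 0 ∧ climb r d = 0 := by
  have key : ∀ a b : ℝ, (a ≠ 0 ∨ b ≠ 0) → (q 0 - p 0) * a + (q 1 - p 1) * b = 0 →
      (r 0 - p 0) * a + (r 1 - p 1) * b = 0 →
      ∃ d : Space3, d ≠ 0 ∧ climb p d = 0 ∧ climb q d = 0 ∧ climb r d = 0 := by
    intro a b hab h1 h2
    refine ⟨!₂[a, b, p 0 * a + p 1 * b], ?_, ?_, ?_, ?_⟩
    · intro h0
      have e0 := congrArg (fun d : Space3 => d 0) h0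
      have e1 := congrArg (fun d : Space3 => d 1) h0
      simp at e0 e1
      rcases hab with hab | hab
      · exact hab e0
      · exact hab e1
    · simp [climb]
    · simp [climb]; linarith
    · simp [climb]; linarith
  simp only [shadow] at h
  by_cases hq : q 0 - p 0 = 0 ∧ q 1 - p 1 = 0
  · by_cases hr : r 0 - p 0 = 0 ∧ r 1 - p 1 = 0
    · exact key 1 0 (by simp) (by simp [hq]) (by simp [hr])
    · refine key (-(r 1 - p 1)) (r 0 - p 0) ?_ (by simp [hq]) (by ring)
      by_contra! h'
      exact hr ⟨h'.2, by linarith [h'.1]⟩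
  · refine key (-(q 1 - p 1)) (q 0 - p 0) ?_ (by ring) (by linarith)
    by_contra! h'
    exact hq ⟨h'.2, by linarith [h'.1]⟩

theorem GeneralPosition3.shadow_ne_zero {H : Set (Set Space3)} (hH : GeneralPosition3 H)
    {S₁ S₂ S₃ : Set Space3} (h₁ : S₁ ∈ H) (h₂ : S₂ ∈ H) (h₃ : S₃ ∈ H) (h₁₂ : S₁ ≠ S₂)
    (h₁₃ : S₁ ≠ S₃) (h₂₃ : S₂ ≠ S₃) :
    shadow (dualPoint S₁) (dualPoint S₂) (dualPoint S₃) ≠ 0 := by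
  intro h
  obtain ⟨d, hd, e₁, e₂, e₃⟩ := exists_climb_eq_zero_of_shadow h
  obtain ⟨x, hx, -⟩ := hH.2.1 S₁ h₁ S₂ h₂ S₃ h₃ h₁₂ h₁₃ h₂₃
  have hx' : x + (1 : ℝ) • d ∈ S₁ ∧ x + (1 : ℝ) • d ∈ S₂ ∧ x + (1 : ℝ) • d ∈ S₃ := by
    rw [(hH.1 _ h₁).mem_iff, (hH.1 _ h₂).mem_iff, (hH.1 _ h₃).mem_iff] at hx ⊢
    simp only [height_add_smul, hx, e₁, e₂, e₃, mul_zero, add_zero, and_self]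
  have := hH.eq_of_mem h₁ h₂ h₃ h₁₂ h₁₃ h₂₃ hx hx'
  simp at this
  exact hd this

theorem GeneralPosition3.volume4_ne_zero {H : Set (Set Space3)} (hH : GeneralPosition3 H)
    {S₁ S₂ S₃ S : Set Space3} (h₁ : S₁ ∈ H) (h₂ : S₂ ∈ H) (h₃ : S₃ ∈ H) (h₁₂ : S₁ ≠ S₂)
    (h₁₃ : S₁ ≠ S₃) (h₂₃ : S₂ ≠ S₃) (hS : S ∈ H) (hS₁ : S ≠ S₁) (hS₂ : S ≠ S₂) (hS₃ : S ≠ S₃) :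
    volume4 (dualPoint S₁) (dualPoint S₂) (dualPoint S₃) (dualPoint S) ≠ 0 := by
  obtain ⟨x, hx, -⟩ := hH.2.1 S₁ h₁ S₂ h₂ S₃ h₃ h₁₂ h₁₃ h₂₃
  rw [volume4_eq_shadow_mul_height ((hH.1 _ h₁).mem_iff.1 hx.1) ((hH.1 _ h₂).mem_iff.1 hx.2.1)
    ((hH.1 _ h₃).mem_iff.1 hx.2.2)]
  refine mul_ne_zero (hH.shadow_ne_zero h₁ h₂ h₃ h₁₂ h₁₃ h₂₃) fun h => ?_
  rcases hH.mem_triple h₁ h₂ h₃ h₁₂ h₁₃ h₂₃ hx hS ((hH.1 _ hS).mem_iff.2 h) with h | h | h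
  · exact hS₁ h
  · exact hS₂ h
  · exact hS₃ h

/-! ### Levels -/

theorem eventually_pos_height {p x : Space3} (h : 0 < height p x) : ∀ᶠ y in 𝓝 x, 0 < height p y :=
  (continuous_height p).continuousAt.eventually (lt_mem_nhds h)

theorem eventually_neg_height {p x : Space3} (h : height p x < 0) : ∀ᶠ y in 𝓝 x, height p y < 0 :=
  (continuous_height p).continuousAt.eventually (gt_mem_nhds h)

/-- Near `x` the position relative to the planes that miss `x` does not change. -/
theorem eventually_same_side {H : Set (Set Space3)} (hf : H.Finite)
    (hH : ∀ S ∈ H, IsNonverticalPlane S) (x : Space3) :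
    ∀ᶠ y in 𝓝 x, ∀ S ∈ H, x ∉ S → y ∉ S ∧ (PassesBelow S y ↔ PassesBelow S x) := by
  rw [Filter.eventually_all_finite hf]
  intro S hS
  by_cases hx : x ∈ S
  · exact Eventually.of_forall fun y h => absurd hx h
  have hx0 := hx
  rw [(hH S hS).mem_iff] at hx0
  rcases lt_or_gt_of_ne hx0 with h | h
  · filter_upwards [eventually_neg_height h] with y hy _
    rw [(hH S hS).mem_iff, (hH S hS).passesBelow_iff, (hH S hS).passesBelow_iff]
    exact ⟨hy.ne, by constructor <;> intro h' <;> linarith⟩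
  · filter_upwards [eventually_pos_height h] with y hy _
    rw [(hH S hS).mem_iff, (hH S hS).passesBelow_iff, (hH S hS).passesBelow_iff]
    exact ⟨hy.ne', by simp [hy, h]⟩

theorem not_passesBelow_of_mem {S : Set Space3} (hS : IsNonverticalPlane S) {x : Space3}
    (hx : x ∈ S) : ¬ PassesBelow S x := by
  rw [hS.passesBelow_iff, hS.mem_iff.1 hx]
  exact lt_irrefl _

/-- Points near `x` see the planes that miss `x` as `x` does; only planes through `x` can change
their position. Hence passing to the closure changes the number of planes below by at most the
number of planes through `x`. -/
theorem of_mem_kLevel {H : Set (Set Space3)} (hf : H.Finite)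
    (hH : ∀ S ∈ H, IsNonverticalPlane S) {k : ℕ} {x : Space3} (hx : x ∈ kLevel H k) :
    (∃ S ∈ H, x ∈ S) ∧ {S ∈ H | PassesBelow S x}.encard + 1 ≤ k ∧
      (k : ℕ∞) ≤ {S ∈ H | PassesBelow S x}.encard + {S ∈ H | x ∈ S}.encard + 1 := by
  obtain ⟨y, hy, ⟨S, ⟨hS, hyS⟩, -⟩, hk⟩ :=
    mem_closure_iff_nhds.1 hx _ (eventually_same_side hf hH x)
  refine ⟨⟨S, hS, ?_⟩, ?_, ?_⟩
  · by_contra h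
    exact (hy S hS h).1 hyS
  · rw [← hk]
    refine add_le_add (Set.encard_le_encard ?_) le_rfl
    rintro T ⟨hT, hTx⟩
    refine ⟨hT, ?_⟩
    have hxT : x ∉ T := fun h => not_passesBelow_of_mem (hH T hT) h hTx
    exact (hy T hT hxT).2.2 hTx
  · rw [← hk]
    refine add_le_add (le_trans (Set.encard_le_encard ?_) (Set.encard_union_le _ _)) le_rfl
    rintro T ⟨hT, hTy⟩
    by_cases hxT : x ∈ T
    · exact Or.inr ⟨hT, hxT⟩
    · exact Or.inl ⟨hT, (hy T hT hxT).2.1 hTy⟩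

/-! ### Cells -/

theorem mem_cellOf_self (H : Set (Set Space3)) (x : Space3) : x ∈ cellOf H x :=
  fun _ _ => ⟨Iff.rfl, Iff.rfl⟩

theorem GeneralPosition3.cellOf_vertex {H : Set (Set Space3)} (hH : GeneralPosition3 H)
    {x : Space3} (hx : IsVertex H x) : cellOf H x = {x} := by
  obtain ⟨S₁, h₁, S₂, h₂, S₃, h₃, h₁₂, h₁₃, h₂₃, x₁, x₂, x₃⟩ := hx
  ext y
  rw [Set.mem_singleton_iff]
  constructor
  · intro hy
    exact hH.eq_of_mem h₁ h₂ h₃ h₁₂ h₁₃ h₂₃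
      ⟨(hy _ h₁).1.2 x₁, (hy _ h₂).1.2 x₂, (hy _ h₃).1.2 x₃⟩ ⟨x₁, x₂, x₃⟩
  · rintro rfl
    exact mem_cellOf_self H y

theorem finrank_vectorSpan_singleton (x : Space3) :
    Module.finrank ℝ (vectorSpan ℝ ({x} : Set Space3)) = 0 := by
  rw [vectorSpan_singleton, finrank_bot]

theorem eq_singleton_of_finrank_eq_zero {F : Set Space3} {x : Space3} (hx : x ∈ F)
    (h : Module.finrank ℝ (vectorSpan ℝ F) = 0) : F = {x} := by
  have h0 : vectorSpan ℝ F = ⊥ := Submodule.finrank_eq_zero.1 h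
  ext y
  rw [Set.mem_singleton_iff]
  constructor
  · intro hy
    have := vsub_mem_vectorSpan ℝ hy hx
    rw [h0, Submodule.mem_bot] at this
    exact vsub_eq_zero_iff_eq.1 this
  · rintro rfl; exact hx

/-- Two distinct non-vertical planes with a common point have a common direction. -/
theorem exists_common_direction {p q : Space3} :
    ∃ d : Space3, d ≠ 0 ∧ climb p d = 0 ∧ climb q d = 0 := by
  have : shadow p q q = 0 := by simp [shadow]; ring
  obtain ⟨d, hd, h1, h2, -⟩ := exists_climb_eq_zero_of_shadow this
  exact ⟨d, hd, h1, h2⟩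

theorem eventually_nhdsGT_add_smul {x d : Space3} {P : Space3 → Prop} (h : ∀ᶠ y in 𝓝 x, P y) :
    ∀ᶠ t in 𝓝[>] (0 : ℝ), P (x + t • d) := by
  have hc : Tendsto (fun t : ℝ => x + t • d) (𝓝 0) (𝓝 x) := by
    have : Continuous fun t : ℝ => x + t • d := by fun_prop
    simpa using this.tendsto 0
  exact (hc.eventually h).filter_mono nhdsWithin_le_nhds

/-- A vertex of the arrangement lies on three planes, if it lies on two. -/
theorem isVertex_of_cellOf_eq_singleton {H : Set (Set Space3)} (hf : H.Finite)
    (hH : ∀ S ∈ H, IsNonverticalPlane S) {x : Space3} (hx : cellOf H x = {x})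
    {S₁ S₂ : Set Space3} (h₁ : S₁ ∈ H) (h₂ : S₂ ∈ H) (h₁₂ : S₁ ≠ S₂) (x₁ : x ∈ S₁) (x₂ : x ∈ S₂) :
    IsVertex H x := by
  by_contra hv
  have honly : ∀ S ∈ H, x ∈ S → S = S₁ ∨ S = S₂ := by
    intro S hS hxS
    by_contra! h
    exact hv ⟨S₁, h₁, S₂, h₂, S, hS, h₁₂, h.1.symm, h.2.symm, x₁, x₂, hxS⟩
  -- If only two planes pass through `x`, a short move along both of them stays in the cell, which
  -- is then not a single point.
  obtain ⟨d, hd, hd₁, hd₂⟩ := exists_common_direction (p := dualPoint S₁) (q := dualPoint S₂)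
  obtain ⟨t, ht, htpos⟩ := ((eventually_nhdsGT_add_smul (d := d)
    (eventually_same_side hf hH x)).and self_mem_nhdsWithin).exists
  have htpos : 0 < t := htpos
  have hmem : x + t • d ∈ cellOf H x := by
    intro S hS
    by_cases hxS : x ∈ S
    · have hc : climb (dualPoint S) d = 0 := by
        rcases honly S hS hxS with rfl | rfl
        · exact hd₁
        · exact hd₂
      rw [(hH S hS).mem_iff, (hH S hS).mem_iff, (hH S hS).passesBelow_iff,
        (hH S hS).passesBelow_iff, height_add_smul, hc]
      simp
    · have := ht S hS hxS
      exact ⟨by simp [this.1, hxS], this.2⟩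
  rw [hx, Set.mem_singleton_iff] at hmem
  have : t • d = 0 := by simpa using hmem
  rcases smul_eq_zero.1 this with h | h
  · exact htpos.ne' h
  · exact hd h

theorem pos_iff_pos_of_ne_zero {f : ℝ → ℝ} (hf : Continuous f) {t : ℝ} (ht : 0 ≤ t)
    (h : ∀ s ∈ Set.Icc 0 t, f s ≠ 0) : 0 < f t ↔ 0 < f 0 := by
  have hsub := intermediate_value_uIcc (a := 0) (b := t) (f := f) hf.continuousOn
  rw [Set.uIcc_of_le ht] at hsub
  have hno : (0 : ℝ) ∉ Set.uIcc (f 0) (f t) := fun h0 => by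
    obtain ⟨s, hs, h0⟩ := hsub h0
    exact h s hs h0
  have h1 := h 0 ⟨le_rfl, ht⟩
  have h2 := h t ⟨ht, le_rfl⟩
  rw [Set.mem_uIcc] at hno
  push Not at hno
  constructor
  · intro h
    by_contra! h'
    exact absurd (hno.1 h') (not_lt.2 h.le)
  · intro h
    by_contra! h'
    exact absurd (hno.2 h') (not_lt.2 h.le)

/-- Every edge of the arrangement of at least three planes ends in a vertex. -/
theorem GeneralPosition3.exists_endpoint {H : Set (Set Space3)} (hH : GeneralPosition3 H)
    (hf : H.Finite) {x : Space3} (hx : ¬ IsVertex H x) {S₁ S₂ S₃ : Set Space3} (h₁ : S₁ ∈ H)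
    (h₂ : S₂ ∈ H) (h₃ : S₃ ∈ H) (h₁₂ : S₁ ≠ S₂) (h₁₃ : S₁ ≠ S₃) (h₂₃ : S₂ ≠ S₃) (x₁ : x ∈ S₁)
    (x₂ : x ∈ S₂) :
    ∃ z ∈ closure (cellOf H x), IsVertex H z ∧
      ∀ S ∈ H, z ∉ S → x ∉ S ∧ (PassesBelow S x ↔ PassesBelow S z) := by
  obtain ⟨y, ⟨y₁, y₂, y₃⟩, -⟩ := hH.2.1 S₁ h₁ S₂ h₂ S₃ h₃ h₁₂ h₁₃ h₂₃
  let g : ℝ → Space3 := fun t => x + t • (y - x)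
  have hg : Continuous g := by fun_prop
  have hg0 : g 0 = x := by simp [g]
  have hg1 : g 1 = y := by simp [g]
  let f : Set Space3 → ℝ → ℝ := fun S t => height (dualPoint S) (g t)
  have hfc : ∀ S, Continuous (f S) := fun S => (continuous_height _).comp hg
  have hfS : ∀ S ∈ H, ∀ t, f S t = 0 ↔ g t ∈ S := fun S hS t => (hH.1 S hS).mem_iff.symm
  have hboth : ∀ S ∈ H, x ∈ S → y ∈ S → ∀ t, g t ∈ S := by
    intro S hS hxS hyS t
    rw [← hfS S hS]
    rw [(hH.1 S hS).mem_iff] at hxS hyS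
    have h1 := height_add_smul (dualPoint S) x (y - x) 1
    have ht := height_add_smul (dualPoint S) x (y - x) t
    rw [one_smul, add_sub_cancel, hyS, hxS] at h1
    simp only [f, g]
    rw [ht, hxS]
    have : climb (dualPoint S) (y - x) = 0 := by linarith
    rw [this]; ring
  -- The walk goes from `x` along the line `S₁ ∩ S₂` towards `S₃`. The first parameter at which a
  -- third plane is met gives the endpoint; before it no position changes.
  let T : Set ℝ := Set.Icc 0 1 ∩ ⋃ S ∈ H \ {S₁, S₂}, {t | f S t = 0}
  have hTc : IsCompact T := by
    refine isCompact_Icc.inter_right ?_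
    exact (hf.subset Set.sdiff_subset).isClosed_biUnion fun S _ =>
      isClosed_eq (hfc S) continuous_const
  have hTne : T.Nonempty := by
    refine ⟨1, ⟨zero_le_one, le_rfl⟩, Set.mem_biUnion (x := S₃) ⟨h₃, ?_⟩ ?_⟩
    · simp [h₁₃.symm, h₂₃.symm]
    · change f S₃ 1 = 0
      rw [hfS S₃ h₃, hg1]
      exact y₃
  obtain ⟨t₀, ⟨⟨ht₀, ht₁⟩, hmem⟩, hleast⟩ := hTc.exists_isLeast hTne
  obtain ⟨S, ⟨hS, hSne⟩, hSt⟩ := Set.mem_iUnion₂.1 hmem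
  simp only [Set.mem_insert_iff, Set.mem_singleton_iff, not_or] at hSne
  have hSt : g t₀ ∈ S := (hfS S hS t₀).1 hSt
  have hnz : ∀ S ∈ H, S ≠ S₁ → S ≠ S₂ → ∀ t, 0 ≤ t → t < t₀ → f S t ≠ 0 := by
    intro S hS hn₁ hn₂ t ht htt h0
    refine absurd (hleast ⟨⟨ht, htt.le.trans ht₁⟩, Set.mem_biUnion (x := S) ⟨hS, ?_⟩ h0⟩) (not_le.2 htt)
    simp [hn₁, hn₂]
  have ht₀pos : 0 < t₀ := by
    refine lt_of_le_of_ne ht₀ fun h => hx ?_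
    rw [← h, hg0] at hSt
    exact ⟨S₁, h₁, S₂, h₂, S, hS, h₁₂, Ne.symm hSne.1, Ne.symm hSne.2, x₁, x₂, hSt⟩
  have hcell : ∀ t ∈ Set.Ico 0 t₀, g t ∈ cellOf H x := by
    intro t ht S hS
    by_cases hS12 : S = S₁ ∨ S = S₂
    · have hxS : x ∈ S := by rcases hS12 with rfl | rfl <;> assumption
      have hyS : y ∈ S := by rcases hS12 with rfl | rfl <;> assumption
      have := hboth S hS hxS hyS t
      exact ⟨by simp [this, hxS], by
        simp [not_passesBelow_of_mem (hH.1 S hS) this, not_passesBelow_of_mem (hH.1 S hS) hxS]⟩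
    · push Not at hS12
      have hn := fun s hs hs' => hnz S hS hS12.1 hS12.2 s hs hs'
      have hpos := pos_iff_pos_of_ne_zero (hfc S) ht.1 fun s hs => hn s hs.1 (hs.2.trans_lt ht.2)
      have e1 := hn t ht.1 ht.2
      have e0 := hn 0 le_rfl ht₀pos
      rw [Ne, hfS S hS] at e0 e1
      rw [hg0] at e0
      refine ⟨by simp [e0, e1], ?_⟩
      rw [(hH.1 S hS).passesBelow_iff, (hH.1 S hS).passesBelow_iff]
      simpa only [f, hg0] using hpos
  refine ⟨g t₀, ?_, ⟨S₁, h₁, S₂, h₂, S, hS, h₁₂, Ne.symm hSne.1, Ne.symm hSne.2,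
    hboth S₁ h₁ x₁ y₁ t₀, hboth S₂ h₂ x₂ y₂ t₀, hSt⟩, ?_⟩
  · refine map_mem_closure hg (s := Set.Ico 0 t₀) ?_ hcell
    rw [closure_Ico ht₀pos.ne]
    exact ⟨ht₀, le_rfl⟩
  · intro S' hS' hz
    have hn₁ : S' ≠ S₁ := by rintro rfl; exact hz (hboth _ hS' x₁ y₁ t₀)
    have hn₂ : S' ≠ S₂ := by rintro rfl; exact hz (hboth _ hS' x₂ y₂ t₀)
    have hn : ∀ s ∈ Set.Icc 0 t₀, f S' s ≠ 0 := by
      intro s hs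
      rcases hs.2.lt_or_eq with h | h
      · exact hnz S' hS' hn₁ hn₂ s hs.1 h
      · rw [h, Ne, hfS S' hS']; exact hz
    have hpos := pos_iff_pos_of_ne_zero (hfc S') ht₀ hn
    have e0 := hn 0 ⟨le_rfl, ht₀⟩
    rw [Ne, hfS S' hS', hg0] at e0
    refine ⟨e0, ?_⟩
    rw [(hH.1 S' hS').passesBelow_iff, (hH.1 S' hS').passesBelow_iff]
    simpa only [f, hg0] using hpos.symm

/-! ### Vertices and edges in the intersection of two levels -/

/-- The vertices of the arrangement of `R ∪ B` in the intersection of two levels. -/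
def levelVertices (R B : Set (Set Space3)) (k k' : ℕ) : Set Space3 :=
  {x | IsVertex (R ∪ B) x ∧ x ∈ kLevel R k ∩ kLevel B k'}

theorem exists_two_planes {R B : Set (Set Space3)} (hRB : Disjoint R B) (hf : (R ∪ B).Finite)
    (hH : GeneralPosition3 (R ∪ B)) {k k' : ℕ} {x : Space3} (hx : x ∈ kLevel R k ∩ kLevel B k') :
    ∃ r ∈ R, ∃ b ∈ B, r ≠ b ∧ x ∈ r ∧ x ∈ b := by
  obtain ⟨⟨r, hr, hxr⟩, -⟩ := of_mem_kLevel (hf.subset Set.subset_union_left)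
    (fun S hS => hH.1 S (Or.inl hS)) hx.1
  obtain ⟨⟨b, hb, hxb⟩, -⟩ := of_mem_kLevel (hf.subset Set.subset_union_right)
    (fun S hS => hH.1 S (Or.inr hS)) hx.2
  exact ⟨r, hr, b, hb, fun h => Set.disjoint_left.1 hRB hr (h ▸ hb), hxr, hxb⟩

theorem encard_vertices {R B : Set (Set Space3)} (hRB : Disjoint R B) (hf : (R ∪ B).Finite)
    (hH : GeneralPosition3 (R ∪ B)) (k k' : ℕ) :
    {F ∈ cells (R ∪ B) 0 | F ⊆ kLevel R k ∩ kLevel B k'}.encard =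
      (levelVertices R B k k').encard := by
  have hinj : Function.Injective fun x : Space3 => ({x} : Set Space3) := Set.singleton_injective
  rw [← hinj.encard_image]
  congr 1
  ext F
  constructor
  · rintro ⟨⟨⟨x, rfl⟩, hdim⟩, hsub⟩
    have hs := eq_singleton_of_finrank_eq_zero (mem_cellOf_self _ x) hdim
    have hx := hsub (mem_cellOf_self _ x)
    obtain ⟨r, hr, b, hb, hrb, hxr, hxb⟩ := exists_two_planes hRB hf hH hx
    exact ⟨x, ⟨isVertex_of_cellOf_eq_singleton hf hH.1 hs (Or.inl hr) (Or.inr hb) hrb hxr hxb, hx⟩,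
      hs.symm⟩
  · rintro ⟨x, ⟨hv, hx⟩, rfl⟩
    refine ⟨⟨⟨x, (hH.cellOf_vertex hv).symm⟩, finrank_vectorSpan_singleton x⟩, ?_⟩
    simpa using hx

/-- Each edge has an endpoint that is a vertex, and levels are closed, so the endpoint lies in `W`.
An edge is determined by its endpoint and its position relative to the at most three planes through
it. With three planes present, every edge has such an endpoint. -/
theorem encard_edges_le {R B : Set (Set Space3)} (hRB : Disjoint R B) (hf : (R ∪ B).Finite)
    (hH : GeneralPosition3 (R ∪ B)) (h3 : 3 ≤ (R ∪ B).encard) (k k' : ℕ) (W : Finset Space3)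
    (hW : levelVertices R B k k' ⊆ W) :
    {F ∈ cells (R ∪ B) 1 | F ⊆ kLevel R k ∩ kLevel B k'}.encard ≤ ((64 * W.card : ℕ) : ℕ∞) := by
  classical
  set H := R ∪ B with hHdef
  set E := {F ∈ cells H 1 | F ⊆ kLevel R k ∩ kLevel B k'}
  have hclosed : IsClosed (kLevel R k ∩ kLevel B k') := isClosed_closure.inter isClosed_closure
  have key : ∀ F ∈ E, ∃ x z, F = cellOf H x ∧ z ∈ W ∧
      ∀ S ∈ H, z ∉ S → x ∉ S ∧ (PassesBelow S x ↔ PassesBelow S z) := by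
    rintro _ ⟨⟨⟨x, rfl⟩, hdim⟩, hsub⟩
    obtain ⟨r, hr, b, hb, hrb, hxr, hxb⟩ :=
      exists_two_planes hRB hf hH (hsub (mem_cellOf_self _ x))
    have hx : ¬ IsVertex H x := by
      intro hv
      rw [hH.cellOf_vertex hv, finrank_vectorSpan_singleton] at hdim
      exact zero_ne_one hdim
    obtain ⟨c, hc, hcr, hcb⟩ : ∃ c ∈ H, c ≠ r ∧ c ≠ b := by
      by_contra! h
      have hsub : H ⊆ {r, b} := by
        intro c hc
        by_cases hcr : c = r
        · simp [hcr]
        · simp [h c hc hcr]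
      have := h3.trans ((Set.encard_le_encard hsub).trans (Set.encard_insert_le _ _))
      rw [Set.encard_singleton] at this
      norm_num at this
    obtain ⟨z, hz, hzv, hzS⟩ := hH.exists_endpoint hf hx (Or.inl hr) (Or.inr hb) hc hrb hcr.symm
      hcb.symm hxr hxb
    exact ⟨x, z, rfl, hW ⟨hzv, closure_minimal hsub hclosed hz⟩, hzS⟩
  choose! X Z hX hZ hS using key
  have honf : ∀ z, {S ∈ H | z ∈ S}.Finite := fun z => hf.subset fun _ h => h.1
  let on : Space3 → Finset (Set Space3) := fun z => (honf z).toFinset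
  have hon : ∀ z, (on z).card ≤ 3 := by
    intro z
    have := hH.2.2 z
    rw [(honf z).encard_eq_coe_toFinset_card] at this
    exact_mod_cast this
  -- The code of an edge: its endpoint, and which planes through the endpoint contain the edge or
  -- pass below it. Two subsets of at most three planes leave `8 · 8 = 64` codes per endpoint.
  let G : Set Space3 → Space3 × (Finset (Set Space3) × Finset (Set Space3)) := fun F =>
    (Z F, ((on (Z F)).filter fun S => X F ∈ S), (on (Z F)).filter fun S => PassesBelow S (X F))
  let T : Finset (Space3 × (Finset (Set Space3) × Finset (Set Space3))) :=
    W.biUnion fun z => {z} ×ˢ ((on z).powerset ×ˢ (on z).powerset)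
  have hT : T.card ≤ W.card * 64 := by
    refine Finset.card_biUnion_le_card_mul _ _ _ fun z _ => ?_
    rw [Finset.card_product, Finset.card_product, Finset.card_singleton, Finset.card_powerset]
    have : 2 ^ (on z).card ≤ 2 ^ 3 := Nat.pow_le_pow_right (by norm_num) (hon z)
    have := Nat.mul_le_mul this this
    omega
  have hmaps : Set.MapsTo G E T := by
    intro F hF
    simp only [T, G, Finset.coe_biUnion, Set.mem_iUnion]
    exact ⟨Z F, hZ F hF, by simp⟩
  have hinj : Set.InjOn G E := by
    intro F hF F' hF' h
    simp only [G, Prod.mk.injEq] at h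
    obtain ⟨hz, h1, h2⟩ := h
    rw [hX F hF, hX F' hF']
    suffices hsame : ∀ S ∈ H, (X F ∈ S ↔ X F' ∈ S) ∧
        (PassesBelow S (X F) ↔ PassesBelow S (X F')) by
      ext y
      exact ⟨fun hy S hS => ⟨(hy S hS).1.trans (hsame S hS).1, (hy S hS).2.trans (hsame S hS).2⟩,
        fun hy S hS => ⟨(hy S hS).1.trans (hsame S hS).1.symm,
          (hy S hS).2.trans (hsame S hS).2.symm⟩⟩
    intro S hSH
    by_cases hzS : Z F ∈ S
    · have hm : S ∈ on (Z F) := (honf _).mem_toFinset.2 ⟨hSH, hzS⟩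
      have hm' : S ∈ on (Z F') := hz ▸ hm
      have e1 := Finset.ext_iff.1 h1 S
      have e2 := Finset.ext_iff.1 h2 S
      simp only [Finset.mem_filter, hm, hm', true_and] at e1 e2
      exact ⟨e1, e2⟩
    · obtain ⟨a1, a2⟩ := hS F hF S hSH hzS
      obtain ⟨b1, b2⟩ := hS F' hF' S hSH (hz ▸ hzS)
      exact ⟨by simp [a1, b1], by rw [a2, b2, hz]⟩
  calc E.encard ≤ (T : Set _).encard := Set.encard_le_encard_of_injOn hmaps hinj
    _ = (T.card : ℕ∞) := Set.encard_coe_eq_coe_finsetCard T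
    _ ≤ ((64 * W.card : ℕ) : ℕ∞) := by exact_mod_cast (by omega)

/-! ### The upper bound -/

/-- A linear change of coordinates that turns the functional `v` into the weight coordinate and
preserves orientation. Its determinant is the square of a nonzero entry of `v`. -/
theorem exists_frame {v : Fin 3 → ℝ} (hv : v ≠ 0) :
    ∃ T : (Fin 3 → ℝ) → Fin 3 → ℝ, (∀ u, T u 0 = v 0 * u 0 + v 1 * u 1 + v 2 * u 2) ∧
      ∃ c : ℝ, 0 < c ∧ ∀ u w z, det3 (T u) (T w) (T z) = c * det3 u w z := by
  by_cases h0 : v 0 = 0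
  · by_cases h1 : v 1 = 0
    · have h2 : v 2 ≠ 0 := fun h2 => hv (by ext i; fin_cases i <;> simp [h0, h1, h2])
      refine ⟨fun u => ![v 0 * u 0 + v 1 * u 1 + v 2 * u 2, u 0, v 2 * u 1], fun u => rfl,
        v 2 ^ 2, by positivity, fun u w z => ?_⟩
      simp [det3]; ring
    · refine ⟨fun u => ![v 0 * u 0 + v 1 * u 1 + v 2 * u 2, u 2, v 1 * u 0], fun u => rfl,
        v 1 ^ 2, by positivity, fun u w z => ?_⟩
      simp [det3]; ring
  · refine ⟨fun u => ![v 0 * u 0 + v 1 * u 1 + v 2 * u 2, u 1, v 0 * u 2], fun u => rfl,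
      v 0 ^ 2, by positivity, fun u w z => ?_⟩
    simp [det3]; ring

theorem orient_eq_zero_of_not_distinct {ι : Type*} (p : ι → ℝ × ℝ) {i j k : ι}
    (h : ¬ (i ≠ j ∧ i ≠ k ∧ j ≠ k)) : orient (p i) (p j) (p k) = 0 := by
  have : i = j ∨ i = k ∨ j = k := by tauto
  rcases this with rfl | rfl | rfl <;> simp only [orient] <;> ring

/-- Vectors in a closed half-space are homogeneous coordinates of planar points, after a
perturbation of those at infinity. The planar bound thus carries over with determinants in place of
orientations. -/
theorem EdgeBound.card_levelEdges_vectors_le {m C : ℕ} (hC : EdgeBound m C) {ι : Type}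
    [Fintype ι] (u : ι → Fin 3 → ℝ) {v : Fin 3 → ℝ} (hv : v ≠ 0)
    (hu : ∀ i, 0 ≤ v 0 * u i 0 + v 1 * u i 1 + v 2 * u i 2)
    (hdet : ∀ i j k, i ≠ j → i ≠ k → j ≠ k → det3 (u i) (u j) (u k) ≠ 0)
    (hm : Fintype.card ι ≤ m) (a : ℕ) :
    (levelEdges (fun i j k => det3 (u i) (u j) (u k)) a).card ≤ C := by
  obtain ⟨T, hT0, c, hc, hT⟩ := exists_frame hv
  obtain ⟨q, hq, hsign⟩ := exists_genPos_of_vectors (fun i => T (u i)) fun i => by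
    rw [hT0]; exact hu i
  refine le_of_eq_of_le ?_ (hC ι q hq hm a)
  congr 1
  refine levelEdges_congr (fun i j k => ?_) a
  obtain ⟨h1, h2⟩ := hsign i j k
  simp only [hT, mul_pos_iff_of_pos_left hc, mul_neg_left_of_pos hc] at h1 h2
  refine ⟨h1, fun h => ?_⟩
  by_cases hd : i ≠ j ∧ i ≠ k ∧ j ≠ k
  · rcases lt_or_gt_of_ne (hdet i j k hd.1 hd.2.1 hd.2.2) with h' | h'
    · exact absurd (h2 h') (not_lt.2 (le_of_lt h))
    · exact h'
  · simp [chirotope, orient_eq_zero_of_not_distinct q hd] at h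

theorem shadow_swap (p q r : Space3) : shadow p r q = - shadow p q r := by
  simp only [shadow]; ring

/-- The points of a level of `R` on two planes of `R` and one plane of `B`. -/
theorem EdgeBound.exists_finset_of_levelPoints {m C : ℕ} (hC : EdgeBound m C)
    {R B : Set (Set Space3)} (hRB : Disjoint R B) (hf : (R ∪ B).Finite)
    (hH : GeneralPosition3 (R ∪ B)) (hR : R.ncard ≤ m) {v : Space3} (hv : v ≠ 0)
    (hsep : ∀ r ∈ R, ∀ b ∈ B, inner ℝ v (dualPoint b) ≤ inner ℝ v (dualPoint r)) (k : ℕ) :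
    ∃ W : Finset Space3, W.card ≤ B.ncard * (4 * C) ∧
      ∀ x, ∀ r₁ ∈ R, ∀ r₂ ∈ R, ∀ b ∈ B, r₁ ≠ r₂ → x ∈ r₁ → x ∈ r₂ → x ∈ b → x ∈ kLevel R k →
        x ∈ W := by
  classical
  have : Fintype R := (hf.subset Set.subset_union_left).fintype
  have : Fintype B := (hf.subset Set.subset_union_right).fintype
  have hne : ∀ r ∈ R, ∀ b ∈ B, b ≠ r := fun r hr b hb h => Set.disjoint_left.1 hRB hr (h ▸ hb)
  let D : B → R → R → R → ℝ := fun b r₁ r₂ r =>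
    volume4 (dualPoint b) (dualPoint r₁) (dualPoint r₂) (dualPoint r)
  let pt : B → R × R → Space3 := fun b e =>
    Classical.epsilon fun x => x ∈ (b : Set Space3) ∧ x ∈ (e.1 : Set Space3) ∧
      x ∈ (e.2 : Set Space3)
  -- Projection from the dual point of `b`: the separation puts all difference vectors into one
  -- half-space.
  have hD : ∀ b a, (levelEdges (D b) a).card ≤ C := by
    intro b a
    refine hC.card_levelEdges_vectors_le (ι := R)
      (fun r i => dualPoint (r : Set Space3) i - dualPoint (b : Set Space3) i)
      (v := fun i => v i) ?_ ?_ ?_ ?_ a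
    · intro h
      exact hv (by ext i; exact congrFun h i)
    · intro r
      have := hsep r r.2 b b.2
      rw [inner_space3, inner_space3] at this
      dsimp only
      linarith
    · intro i j l hij hil hjl
      have hij' : (i : Set Space3) ≠ j := fun h => hij (Subtype.ext h)
      have hil' : (l : Set Space3) ≠ i := fun h => hil (Subtype.ext h.symm)
      have hjl' : (l : Set Space3) ≠ j := fun h => hjl (Subtype.ext h.symm)
      exact hH.volume4_ne_zero (Or.inr b.2) (Or.inl i.2) (Or.inl j.2) (hne _ i.2 _ b.2)
        (hne _ j.2 _ b.2) hij' (Or.inl l.2) (hne _ l.2 _ b.2).symm hil' hjl'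
    · rwa [← Nat.card_coe_set_eq, Nat.card_eq_fintype_card] at hR
  -- The number of planes of `R` below a point of the `k`-level is `k - 1 - o` with `o ≤ 3`, because
  -- at most three planes pass through the point.
  refine ⟨Finset.univ.biUnion fun b : B => (Finset.range 4).biUnion fun o =>
    (levelEdges (D b) (k - 1 - o)).image (pt b), ?_, ?_⟩
  · refine (Finset.card_biUnion_le_card_mul _ _ (4 * C) fun b _ => ?_).trans ?_
    · refine (Finset.card_biUnion_le_card_mul _ _ C fun o _ => ?_).trans ?_
      · exact Finset.card_image_le.trans (hD b _)
      · rw [Finset.card_range]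
    · rw [Finset.card_univ, ← Nat.card_coe_set_eq, Nat.card_eq_fintype_card]
  -- The sign of the shadow decides in which order `r₁`, `r₂` form an edge whose positive side
  -- counts the planes below `x`.
  · have main : ∀ x, ∀ r₁ ∈ R, ∀ r₂ ∈ R, ∀ b ∈ B, r₁ ≠ r₂ → x ∈ r₁ → x ∈ r₂ → x ∈ b →
        x ∈ kLevel R k → 0 < shadow (dualPoint b) (dualPoint r₁) (dualPoint r₂) →
        x ∈ Finset.univ.biUnion fun b : B => (Finset.range 4).biUnion fun o =>
          (levelEdges (D b) (k - 1 - o)).image (pt b) := by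
      intro x r₁ hr₁ r₂ hr₂ b hb hne₁₂ hx₁ hx₂ hxb hxk hpos
      obtain ⟨-, hk1, hk2⟩ := of_mem_kLevel (hf.subset Set.subset_union_left)
        (fun S hS => hH.1 S (Or.inl hS)) hxk
      have h3 : {S ∈ R | x ∈ S}.encard ≤ 3 := (hH.mono Set.subset_union_left).2.2 x
      rw [encard_sep_eq] at hk1 hk2 h3
      rw [encard_sep_eq] at hk2
      norm_cast at hk1 hk2 h3
      set β := (Finset.univ.filter fun i : R => PassesBelow (i : Set Space3) x).card with hβ
      refine Finset.mem_biUnion.2 ⟨⟨b, hb⟩, Finset.mem_univ _, Finset.mem_biUnion.2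
        ⟨k - 1 - β, Finset.mem_range.2 (by omega), Finset.mem_image.2
          ⟨(⟨r₁, hr₁⟩, ⟨r₂, hr₂⟩), mem_levelEdges.2 ⟨?_, ?_⟩, ?_⟩⟩⟩
      · exact fun h => hne₁₂ (congrArg Subtype.val h)
      · have : k - 1 - (k - 1 - β) = β := by omega
        rw [this, hβ]
        congr 1
        refine Finset.filter_congr fun r _ => ?_
        simp only [D]
        rw [volume4_eq_shadow_mul_height ((hH.1 _ (Or.inr hb)).mem_iff.1 hxb)
          ((hH.1 _ (Or.inl hr₁)).mem_iff.1 hx₁) ((hH.1 _ (Or.inl hr₂)).mem_iff.1 hx₂),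
          mul_pos_iff_of_pos_left hpos, (hH.1 _ (Or.inl r.2)).passesBelow_iff]
      · have hspec : pt ⟨b, hb⟩ (⟨r₁, hr₁⟩, ⟨r₂, hr₂⟩) ∈ b ∧
            pt ⟨b, hb⟩ (⟨r₁, hr₁⟩, ⟨r₂, hr₂⟩) ∈ r₁ ∧ pt ⟨b, hb⟩ (⟨r₁, hr₁⟩, ⟨r₂, hr₂⟩) ∈ r₂ :=
          Classical.epsilon_spec (p := fun x => x ∈ b ∧ x ∈ r₁ ∧ x ∈ r₂) ⟨x, hxb, hx₁, hx₂⟩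
        exact hH.eq_of_mem (Or.inr hb) (Or.inl hr₁) (Or.inl hr₂) (hne _ hr₁ _ hb)
          (hne _ hr₂ _ hb) hne₁₂ hspec ⟨hxb, hx₁, hx₂⟩
    intro x r₁ hr₁ r₂ hr₂ b hb hne₁₂ hx₁ hx₂ hxb hxk
    rcases lt_or_gt_of_ne (hH.shadow_ne_zero (Or.inr hb) (Or.inl hr₁) (Or.inl hr₂)
      (hne _ hr₁ _ hb) (hne _ hr₂ _ hb) hne₁₂) with h | h
    · exact main x r₂ hr₂ r₁ hr₁ b hb hne₁₂.symm hx₂ hx₁ hxb hxk (by rw [shadow_swap]; linarith)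
    · exact main x r₁ hr₁ r₂ hr₂ b hb hne₁₂ hx₁ hx₂ hxb hxk h

/-- The vertices number at most `4C |B|` with two planes of `R` plus `4C |R|` with two planes of
`B`, that is `4Cn`. With 64 edges per vertex the total is `65 · 4Cn`. -/
theorem le_of_mem_separatedComplexities {n C : ℕ} (hC : EdgeBound n C) (hn : 3 ≤ n) {c : ℕ∞}
    (hc : c ∈ separatedComplexities n) : c ≤ ((260 * C * n : ℕ) : ℕ∞) := by
  classical
  obtain ⟨R, B, k, k', hRB, hcard, hH, ⟨v, a, hv, hvR, hvB⟩, rfl⟩ := hc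
  have hf : (R ∪ B).Finite := Set.finite_of_encard_eq_coe hcard
  have hfR := hf.subset Set.subset_union_left
  have hfB := hf.subset Set.subset_union_right
  have hsum : R.ncard + B.ncard = n := by
    rw [← Set.ncard_union_eq hRB hfR hfB, Set.ncard, hcard]
    simp
  have hR : ∀ r ∈ R, inner ℝ v (dualPoint r) < a := fun r hr => hvR _ (by
    change dualPlane (dualPoint r) ∈ R
    rwa [(hH.1 r (Or.inl hr)).dualPlane_dualPoint])
  have hB : ∀ b ∈ B, a < inner ℝ v (dualPoint b) := fun b hb => hvB _ (by
    change dualPlane (dualPoint b) ∈ B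
    rwa [(hH.1 b (Or.inr hb)).dualPlane_dualPoint])
  obtain ⟨W₁, hW₁, hmem₁⟩ := hC.exists_finset_of_levelPoints hRB hf hH (by omega) (neg_ne_zero.2 hv)
    (fun r hr b hb => by
      rw [inner_neg_left, inner_neg_left]; linarith [hR r hr, hB b hb]) k
  obtain ⟨W₂, hW₂, hmem₂⟩ := hC.exists_finset_of_levelPoints (R := B) (B := R) hRB.symm
    (by rwa [Set.union_comm]) (by rwa [Set.union_comm]) (by omega) hv
    (fun b hb r hr => by linarith [hR r hr, hB b hb]) k'
  have hW : levelVertices R B k k' ⊆ ((W₁ ∪ W₂ : Finset Space3) : Set Space3) := by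
    rintro x ⟨⟨S₁, h₁, S₂, h₂, S₃, h₃, h₁₂, h₁₃, h₂₃, x₁, x₂, x₃⟩, hx⟩
    obtain ⟨r, hr, b, hb, hrb, hxr, hxb⟩ := exists_two_planes hRB hf hH hx
    obtain ⟨S, hS, hSr, hSb, hxS⟩ : ∃ S ∈ R ∪ B, S ≠ r ∧ S ≠ b ∧ x ∈ S := by
      by_contra! h
      have e : ∀ S ∈ R ∪ B, x ∈ S → S = r ∨ S = b := fun S hS hxS => by
        by_contra! h'
        exact h S hS h'.1 h'.2 hxS
      rcases e S₁ h₁ x₁ with e₁ | e₁ <;> rcases e S₂ h₂ x₂ with e₂ | e₂ <;>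
        rcases e S₃ h₃ x₃ with e₃ | e₃ <;> simp_all
    rw [Finset.coe_union]
    rcases hS with hS | hS
    · exact Or.inl (hmem₁ x S hS r hr b hb hSr hxS hxr hxb hx.1)
    · exact Or.inr (hmem₂ x S hS b hb r hr hSb hxS hxb hxr hx.2)
  have hWc : (W₁ ∪ W₂).card ≤ 4 * C * n := by
    refine (Finset.card_union_le _ _).trans ((add_le_add hW₁ hW₂).trans_eq ?_)
    rw [← hsum]; ring
  have hedges := encard_edges_le hRB hf hH (by rw [hcard]; exact_mod_cast hn) k k' _ hW
  have hvert : (levelVertices R B k k').encard ≤ ((W₁ ∪ W₂).card : ℕ∞) := by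
    rw [← Set.encard_coe_eq_coe_finsetCard]
    exact Set.encard_le_encard hW
  rw [intersectionComplexity, encard_vertices hRB hf hH]
  refine (add_le_add hvert hedges).trans ?_
  norm_cast
  calc _ = 65 * (W₁ ∪ W₂).card := by ring
    _ ≤ 65 * (4 * C * n) := Nat.mul_le_mul_left _ hWc
    _ = _ := by ring

/-! ### Configurations in space -/

/-- A configuration in space without vertical or concurrent degeneracies of the dual planes. -/
structure GenPos3 {κ : Type*} (c : κ → Space3) : Prop where
  injective : Function.Injective c
  shadow_ne_zero : ∀ i j k, i ≠ j → i ≠ k → j ≠ k → shadow (c i) (c j) (c k) ≠ 0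
  volume4_ne_zero : ∀ f : Fin 4 → κ, Function.Injective f →
    volume4 (c (f 0)) (c (f 1)) (c (f 2)) (c (f 3)) ≠ 0

theorem exists_common_point {p q r : Space3} (h : shadow p q r ≠ 0) :
    ∃ x, height p x = 0 ∧ height q x = 0 ∧ height r x = 0 := by
  -- Cramer's rule for the horizontal coordinates.
  set a := ((q 2 - p 2) * (r 1 - p 1) - (q 1 - p 1) * (r 2 - p 2)) / shadow p q r with ha
  set b := ((q 0 - p 0) * (r 2 - p 2) - (q 2 - p 2) * (r 0 - p 0)) / shadow p q r with hb
  have ha' : a * shadow p q r = (q 2 - p 2) * (r 1 - p 1) - (q 1 - p 1) * (r 2 - p 2) := by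
    rw [ha]; field_simp
  have hb' : b * shadow p q r = (q 0 - p 0) * (r 2 - p 2) - (q 2 - p 2) * (r 0 - p 0) := by
    rw [hb]; field_simp
  have h1 : (q 0 - p 0) * a + (q 1 - p 1) * b = q 2 - p 2 := by
    apply mul_right_cancel₀ h
    rw [add_mul, mul_assoc, mul_assoc, ha', hb', shadow]
    ring
  have h2 : (r 0 - p 0) * a + (r 1 - p 1) * b = r 2 - p 2 := by
    apply mul_right_cancel₀ h
    rw [add_mul, mul_assoc, mul_assoc, ha', hb', shadow]
    ring
  refine ⟨!₂[a, b, p 0 * a + p 1 * b - p 2], ?_, ?_, ?_⟩ <;> simp [height] <;> linarith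

theorem eq_of_common_point {p q r x y : Space3} (h : shadow p q r ≠ 0)
    (hx : height p x = 0 ∧ height q x = 0 ∧ height r x = 0)
    (hy : height p y = 0 ∧ height q y = 0 ∧ height r y = 0) : x = y := by
  simp only [height] at hx hy
  obtain ⟨x1, x2, x3⟩ := hx
  obtain ⟨y1, y2, y3⟩ := hy
  have h0 : (x 0 - y 0) * shadow p q r = 0 := by
    simp only [shadow]
    linear_combination (r 1 - q 1) * (x1 - y1) + (p 1 - r 1) * (x2 - y2) + (q 1 - p 1) * (x3 - y3)
  have h1 : (x 1 - y 1) * shadow p q r = 0 := by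
    simp only [shadow]
    linear_combination (q 0 - r 0) * (x1 - y1) + (r 0 - p 0) * (x2 - y2) + (p 0 - q 0) * (x3 - y3)
  have h0 := sub_eq_zero.1 ((mul_eq_zero.1 h0).resolve_right h)
  have h1 := sub_eq_zero.1 ((mul_eq_zero.1 h1).resolve_right h)
  ext i
  fin_cases i
  · exact h0
  · exact h1
  · rw [h0, h1] at x1
    simp
    linarith

theorem GenPos3.generalPosition3 {κ : Type*} [Finite κ] {c : κ → Space3} (hc : GenPos3 c) :
    GeneralPosition3 (Set.range fun i => dualPlane (c i)) := by
  refine ⟨?_, ?_, ?_⟩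
  · rintro _ ⟨i, rfl⟩
    exact isNonverticalPlane_iff.2 ⟨_, rfl⟩
  · rintro _ ⟨i, rfl⟩ _ ⟨j, rfl⟩ _ ⟨k, rfl⟩ hij hik hjk
    have hs := hc.shadow_ne_zero i j k (fun h => hij (by rw [h])) (fun h => hik (by rw [h]))
      fun h => hjk (by rw [h])
    obtain ⟨x, hx⟩ := exists_common_point hs
    simp only [mem_dualPlane]
    exact ⟨x, hx, fun y hy => eq_of_common_point hs hy hx⟩
  · intro x
    by_contra! h
    have h4 : (4 : ℕ) ≤ {S | S ∈ (Set.range fun i => dualPlane (c i)) ∧ x ∈ S}.encard := by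
      have := Order.add_one_le_of_lt h
      exact le_trans (by norm_num) this
    obtain ⟨t, ht, htc⟩ := Set.exists_subset_encard_eq h4
    have htf : t.Finite := Set.finite_of_encard_eq_coe htc
    have := htf.fintype
    have hcard : Fintype.card t = 4 := by
      rw [Set.encard_eq_coe_toFinset_card, Set.toFinset_card] at htc
      exact_mod_cast htc
    let e := (Fintype.equivFinOfCardEq hcard).symm
    have hmem : ∀ a : Fin 4, ∃ i, dualPlane (c i) = e a ∧ height (c i) x = 0 := by
      intro a
      obtain ⟨⟨i, hi⟩, hx⟩ := ht (e a).2
      refine ⟨i, hi, ?_⟩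
      rw [← mem_dualPlane]
      change dualPlane (c i) = _ at hi
      rw [hi]; exact hx
    choose f hf hfx using hmem
    have hinj : Function.Injective f := by
      intro a b hab
      apply e.injective
      apply Subtype.ext
      rw [← hf a, ← hf b, hab]
    refine hc.volume4_ne_zero f hinj ?_
    rw [volume4_eq_shadow_mul_height (hfx 0) (hfx 1) (hfx 2), hfx 3, mul_zero]

/-! ### Homogeneous coordinates and perturbation in space -/

/-- The determinant of four vectors. -/
def det4 (a b c d : Fin 4 → ℝ) : ℝ :=
  a 0 * det3 (Fin.tail b) (Fin.tail c) (Fin.tail d) -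
    b 0 * det3 (Fin.tail a) (Fin.tail c) (Fin.tail d) +
    c 0 * det3 (Fin.tail a) (Fin.tail b) (Fin.tail d) -
    d 0 * det3 (Fin.tail a) (Fin.tail b) (Fin.tail c)

theorem det4_eq_det (a b c d : Fin 4 → ℝ) : det4 a b c d = (Matrix.of ![a, b, c, d]).det := by
  simp [Matrix.det_succ_column_zero, Fin.sum_univ_succ, det4, det3, Fin.tail]
  simp [Fin.succAbove]
  ring

/-- The affine point with given homogeneous coordinates (the first one is the weight). -/
noncomputable def dehomogenize4 (w : Fin 4 → ℝ) : Space3 := !₂[w 1 / w 0, w 2 / w 0, w 3 / w 0]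

theorem volume4_dehomogenize4 {a b c d : Fin 4 → ℝ} (ha : 0 < a 0) (hb : 0 < b 0) (hc : 0 < c 0)
    (hd : 0 < d 0) :
    volume4 (dehomogenize4 a) (dehomogenize4 b) (dehomogenize4 c) (dehomogenize4 d) =
      det4 a b c d / (a 0 * b 0 * c 0 * d 0) := by
  simp [volume4, dehomogenize4, det4, det3, Fin.tail]
  field_simp
  ring

theorem shadow_dehomogenize4 {a b c : Fin 4 → ℝ} (ha : 0 < a 0) (hb : 0 < b 0) (hc : 0 < c 0) :
    shadow (dehomogenize4 a) (dehomogenize4 b) (dehomogenize4 c) =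
      det3 (Fin.init a) (Fin.init b) (Fin.init c) / (a 0 * b 0 * c 0) := by
  simp [shadow, dehomogenize4, det3, Fin.init]
  field_simp
  ring

/-- Every finite vector configuration in a closed half-space can be perturbed to a configuration in
general position that has the same orientations of quadruples and respects the first coordinate. -/
theorem exists_genPos3_of_vectors {κ : Type*} [Finite κ] (v : κ → Fin 4 → ℝ)
    (h0 : ∀ i, 0 ≤ v i 0) :
    ∃ c : κ → Space3, GenPos3 c ∧
      (∀ i j k l, (0 < det4 (v i) (v j) (v k) (v l) → 0 < volume4 (c i) (c j) (c k) (c l)) ∧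
        (det4 (v i) (v j) (v k) (v l) < 0 → volume4 (c i) (c j) (c k) (c l) < 0)) ∧
      ∀ i, (0 < v i 1 → 0 < c i 0) ∧ (v i 1 < 0 → c i 0 < 0) := by
  obtain ⟨s, hs⟩ := exists_injective_real κ
  have h4 := eventually_det_perturb_ne_zero v hs
  have h3 := eventually_det_perturb_ne_zero (d := 3) (fun i => Fin.init (v i)) hs
  -- The minors of size 4, 3 and 2 yield nonzero volumes, nonzero shadows and distinct points,
  -- respectively.
  have h2 := eventually_det_perturb_ne_zero (d := 2) (fun i => Fin.init (Fin.init (v i))) hs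
  have hcv := continuous_perturb v s
  have hc : ∀ i j k l, Continuous fun t =>
      det4 (perturb v s t i) (perturb v s t j) (perturb v s t k) (perturb v s t l) := by
    intro i j k l
    unfold det4 det3 Fin.tail
    fun_prop (disch := assumption)
  have hp : ∀ᶠ t in 𝓝[>] (0 : ℝ), ∀ i j k l, 0 < det4 (v i) (v j) (v k) (v l) →
      0 < det4 (perturb v s t i) (perturb v s t j) (perturb v s t k) (perturb v s t l) := by
    simp only [eventually_all]
    intro i j k l h
    exact eventually_pos_of_continuous (hc i j k l) (by simpa only [perturb_zero] using h)
  have hn : ∀ᶠ t in 𝓝[>] (0 : ℝ), ∀ i j k l, det4 (v i) (v j) (v k) (v l) < 0 →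
      det4 (perturb v s t i) (perturb v s t j) (perturb v s t k) (perturb v s t l) < 0 := by
    simp only [eventually_all]
    intro i j k l h
    exact eventually_neg_of_continuous (hc i j k l) (by simpa only [perturb_zero] using h)
  have hp1 : ∀ᶠ t in 𝓝[>] (0 : ℝ), ∀ i, 0 < v i 1 → 0 < perturb v s t i 1 := by
    simp only [eventually_all]
    intro i h
    exact eventually_pos_of_continuous (hcv i 1) (by simpa only [perturb_zero] using h)
  have hn1 : ∀ᶠ t in 𝓝[>] (0 : ℝ), ∀ i, v i 1 < 0 → perturb v s t i 1 < 0 := by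
    simp only [eventually_all]
    intro i h
    exact eventually_neg_of_continuous (hcv i 1) (by simpa only [perturb_zero] using h)
  obtain ⟨t, h4, h3, h2, hp, hn, hp1, hn1, ht⟩ :=
    (h4.and (h3.and (h2.and (hp.and (hn.and (hp1.and (hn1.and self_mem_nhdsWithin))))))).exists
  have ht : 0 < t := ht
  have hw : ∀ i, 0 < perturb v s t i 0 := fun i => by
    have := h0 i
    simp only [perturb, Fin.val_zero, pow_zero, mul_one]; linarith
  refine ⟨fun i => dehomogenize4 (perturb v s t i), ⟨?_, ?_, ?_⟩, ?_, ?_⟩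
  · intro i j hij
    by_contra hne
    apply h2 ![i, j] (injective_vec2 hne)
    have hij : perturb v s t i 1 / perturb v s t i 0 = perturb v s t j 1 / perturb v s t j 0 := by
      simpa [dehomogenize4] using congrArg (fun x : Space3 => x 0) hij
    rw [div_eq_div_iff (hw i).ne' (hw j).ne'] at hij
    simp only [perturb, Fin.val_zero, Fin.val_one] at hij
    simp [Matrix.det_fin_two, perturb, Fin.init] at hij ⊢
    linarith
  · intro i j k hij hik hjk
    rw [shadow_dehomogenize4 (hw i) (hw j) (hw k)]
    refine div_ne_zero ?_ (mul_pos (mul_pos (hw i) (hw j)) (hw k)).ne'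
    have := h3 ![i, j, k] (injective_vec3 hij hik hjk)
    rw [det3_eq_det]
    convert this using 3
    ext a
    fin_cases a <;> rfl
  · intro f hf
    rw [volume4_dehomogenize4 (hw _) (hw _) (hw _) (hw _)]
    refine div_ne_zero ?_ (mul_pos (mul_pos (mul_pos (hw _) (hw _)) (hw _)) (hw _)).ne'
    have := h4 f hf
    rw [det4_eq_det]
    convert this using 3
    ext a
    fin_cases a <;> rfl
  · intro i j k l
    dsimp only
    rw [volume4_dehomogenize4 (hw i) (hw j) (hw k) (hw l)]
    have hpos := mul_pos (mul_pos (mul_pos (hw i) (hw j)) (hw k)) (hw l)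
    exact ⟨fun h => div_pos (hp i j k l h) hpos,
      fun h => div_neg_of_neg_of_pos (hn i j k l h) hpos⟩
  · intro i
    have : dehomogenize4 (perturb v s t i) 0 = perturb v s t i 1 / perturb v s t i 0 := by
      simp [dehomogenize4]
    rw [this]
    exact ⟨fun h => div_pos (hp1 i h) (hw i), fun h => div_neg_of_neg_of_pos (hn1 i h) (hw i)⟩

/-! ### Points of levels -/

theorem mem_kLevel_of_unique {H : Set (Set Space3)} {k : ℕ} {x : Space3} {S : Set Space3}
    (hS : S ∈ H) (hx : x ∈ S) (huniq : ∀ T ∈ H, x ∈ T → T = S)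
    (hk : {S ∈ H | PassesBelow S x}.encard + 1 = k) : x ∈ kLevel H k :=
  subset_closure ⟨⟨S, ⟨hS, hx⟩, fun T hT => huniq T hT.1 hT.2⟩, hk⟩

/-- A point on exactly two planes lies on two consecutive levels. -/
theorem mem_kLevel_of_two {H : Set (Set Space3)} (hf : H.Finite)
    (hH : ∀ S ∈ H, IsNonverticalPlane S) {k : ℕ} {x : Space3} {S₁ S₂ : Set Space3} (h₁ : S₁ ∈ H)
    (h₂ : S₂ ∈ H) (x₁ : x ∈ S₁) (x₂ : x ∈ S₂) (honly : ∀ T ∈ H, x ∈ T → T = S₁ ∨ T = S₂)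
    {d : Space3} (hd₁ : climb (dualPoint S₁) d = 0) (hd₂ : climb (dualPoint S₂) d ≠ 0)
    (hk : {S ∈ H | PassesBelow S x}.encard + 1 = k ∨ {S ∈ H | PassesBelow S x}.encard + 2 = k) :
    x ∈ kLevel H k := by
  -- A move along `S₁` away from `S₂` reaches points on `S₁` alone. There `S₂` passes below exactly
  -- if the move ascends relative to `S₂`, so `d` and `-d` give the two levels.
  have key : ∀ d : Space3, climb (dualPoint S₁) d = 0 → climb (dualPoint S₂) d ≠ 0 →
      (if 0 < climb (dualPoint S₂) d then {S ∈ H | PassesBelow S x}.encard + 2 = k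
        else {S ∈ H | PassesBelow S x}.encard + 1 = k) → x ∈ kLevel H k := by
    intro d hd₁ hd₂ hk
    have hev := (eventually_nhdsGT_add_smul (d := d)
      (eventually_same_side hf hH x)).and self_mem_nhdsWithin
    have hc : Tendsto (fun t : ℝ => x + t • d) (𝓝[>] 0) (𝓝 x) := by
      have : Continuous fun t : ℝ => x + t • d := by fun_prop
      have := this.tendsto 0
      simp only [zero_smul, add_zero] at this
      exact this.mono_left nhdsWithin_le_nhds
    refine mem_closure_of_tendsto hc (hev.mono ?_)
    rintro t ⟨ht, htpos⟩
    have htpos : 0 < t := htpos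
    have e₁ : height (dualPoint S₁) (x + t • d) = 0 := by
      rw [height_add_smul, (hH _ h₁).mem_iff.1 x₁, hd₁]; ring
    have e₂ : height (dualPoint S₂) (x + t • d) = t * climb (dualPoint S₂) d := by
      rw [height_add_smul, (hH _ h₂).mem_iff.1 x₂]; ring
    have hS₂ : x + t • d ∉ S₂ := by
      rw [(hH _ h₂).mem_iff, e₂]; exact mul_ne_zero htpos.ne' hd₂
    refine ⟨⟨S₁, ⟨h₁, (hH _ h₁).mem_iff.2 e₁⟩, ?_⟩, ?_⟩
    · rintro T ⟨hT, hyT⟩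
      have hxT : x ∈ T := by
        by_contra h
        exact (ht T hT h).1 hyT
      rcases honly T hT hxT with rfl | rfl
      · rfl
      · exact absurd hyT hS₂
    · have hn₁ : ¬ PassesBelow S₁ (x + t • d) := by
        rw [(hH _ h₁).passesBelow_iff, e₁]; exact lt_irrefl _
      have hiff₂ : PassesBelow S₂ (x + t • d) ↔ 0 < climb (dualPoint S₂) d := by
        rw [(hH _ h₂).passesBelow_iff, e₂]; exact mul_pos_iff_of_pos_left htpos
      have hsame : ∀ T ∈ H, T ≠ S₂ → (PassesBelow T (x + t • d) ↔ PassesBelow T x) := by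
        intro T hT hne
        by_cases hxT : x ∈ T
        · rcases honly T hT hxT with rfl | rfl
          · simp [hn₁, not_passesBelow_of_mem (hH _ h₁) x₁]
          · exact absurd rfl hne
        · exact (ht T hT hxT).2
      have hn₂ := not_passesBelow_of_mem (hH _ h₂) x₂
      split_ifs at hk with hpos
      · have hset : {S ∈ H | PassesBelow S (x + t • d)} =
            insert S₂ {S ∈ H | PassesBelow S x} := by
          ext T
          simp only [Set.mem_ofPred_eq, Set.mem_insert_iff]
          by_cases hT : T = S₂
          · subst hT; simp [h₂, hiff₂, hpos]
          · simp only [hT, false_or, and_congr_right_iff]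
            exact fun h => hsame T h hT
        rw [hset, Set.encard_insert_of_notMem (fun h => hn₂ h.2), ← hk, add_assoc]
        norm_num
      · have hset : {S ∈ H | PassesBelow S (x + t • d)} = {S ∈ H | PassesBelow S x} := by
          ext T
          simp only [Set.mem_ofPred_eq, and_congr_right_iff]
          intro hTH
          by_cases hT : T = S₂
          · subst hT; simp [hiff₂, hpos, hn₂]
          · exact hsame T hTH hT
        rw [hset, hk]
  have hneg : climb (dualPoint S₁) (-d) = 0 := by simp [climb] at hd₁ ⊢; linarith
  have hneg₂ : climb (dualPoint S₂) (-d) = -climb (dualPoint S₂) d := by simp [climb]; ring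
  rcases lt_or_gt_of_ne hd₂ with h | h <;> rcases hk with hk | hk
  · exact key d hd₁ hd₂ (by rwa [if_neg (not_lt.2 h.le)])
  · exact key (-d) hneg (by rw [hneg₂]; exact neg_ne_zero.2 hd₂)
      (by rwa [hneg₂, if_pos (neg_pos.2 h)])
  · exact key (-d) hneg (by rw [hneg₂]; exact neg_ne_zero.2 hd₂)
      (by rwa [hneg₂, if_neg (by linarith)])
  · exact key d hd₁ hd₂ (by rwa [if_pos h])

theorem exists_climb_ne_zero {p q r : Space3} (h : shadow p q r ≠ 0) :
    ∃ d : Space3, climb p d = 0 ∧ climb q d ≠ 0 := by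
  by_contra! hall
  have h0 := hall !₂[1, 0, p 0] (by simp [climb])
  have h1 := hall !₂[0, 1, p 1] (by simp [climb])
  simp [climb] at h0 h1
  apply h
  simp only [shadow]
  rw [show q 0 - p 0 = 0 by linarith, show q 1 - p 1 = 0 by linarith]
  ring

/-! ### The lower bound -/

/-- The sign pattern of the vectors `(-1)ˡ (1, l)`: the determinants of the `l`-th and the `l'`-th. -/
def altSign (l l' : ℕ) : ℝ := (-1) ^ l * (-1) ^ l' * ((l' : ℝ) - l)

theorem altSign_pos_iff {l l' : ℕ} :
    0 < altSign l l' ↔ (l < l' ∧ (l' + l) % 2 = 0) ∨ (l' < l ∧ (l' + l) % 2 = 1) := by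
  rw [altSign, ← pow_add]
  rcases Nat.mod_two_eq_zero_or_one (l + l') with h | h
  · rw [Even.neg_one_pow (Nat.even_iff.2 h), one_mul, sub_pos, Nat.cast_lt]
    omega
  · rw [Odd.neg_one_pow (Nat.odd_iff.2 h), neg_one_mul, neg_pos, sub_neg, Nat.cast_lt]
    omega

theorem altSign_eq_zero_iff {l l' : ℕ} : altSign l l' = 0 ↔ l' = l := by
  simp [altSign, sub_eq_zero]

/-- Positive are the earlier indices of the opposite parity and the later ones of the same parity;
each kind makes up about half of its range. -/
theorem card_altSign_pos_range (l N : ℕ) :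
    ((Finset.range N).filter fun l' => 0 < altSign l l').card =
      if N ≤ l then (N + l % 2) / 2 else (l + l % 2) / 2 + (N - 1 - l) / 2 := by
  induction N with
  | zero => simp
  | succ N ih =>
    rw [Finset.range_add_one, Finset.filter_insert]
    split_ifs at ih ⊢ with h1 h2 h3 <;>
      first
      | rw [Finset.card_insert_of_notMem (by simp), ih]; rw [altSign_pos_iff] at h1; omega
      | rw [ih]; rw [altSign_pos_iff] at h1; omega

/-- Every line through the origin and one of the points halves the alternating configuration. -/
theorem card_altSign {j : ℕ} (l : Fin (2 * j + 1)) {s : ℝ} (hs : s ≠ 0) :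
    (Finset.univ.filter fun l' : Fin (2 * j + 1) => 0 < s * altSign l l').card = j := by
  have hpos : (Finset.univ.filter fun l' : Fin (2 * j + 1) => 0 < altSign l l').card = j := by
    have h := card_altSign_pos_range l (2 * j + 1)
    rw [if_neg (by omega)] at h
    have e : (Finset.range (2 * j + 1)).filter (fun l' => 0 < altSign l l') =
        (Finset.univ.filter fun l' : Fin (2 * j + 1) => 0 < altSign l l').map Fin.valEmbedding := by
      ext a
      simp only [Finset.mem_filter, Finset.mem_range, Finset.mem_map, Finset.mem_univ, true_and,
        Fin.valEmbedding_apply]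
      constructor
      · rintro ⟨ha, h⟩; exact ⟨⟨a, ha⟩, h, rfl⟩
      · rintro ⟨b, hb, rfl⟩; exact ⟨b.2, hb⟩
    rw [e, Finset.card_map] at h
    omega
  have hzero : (Finset.univ.filter fun l' : Fin (2 * j + 1) => altSign l l' = 0).card = 1 := by
    rw [Finset.card_eq_one]
    exact ⟨l, by ext l'; simp [altSign_eq_zero_iff, Fin.ext_iff]⟩
  have htot := (card_filter_trichotomy Finset.univ
    (fun l' : Fin (2 * j + 1) => altSign l l') 0).1
  rw [hzero, Finset.card_univ, Fintype.card_fin] at htot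
  rcases lt_or_gt_of_ne hs with h | h
  · simp only [mul_pos_left_of_neg h]
    omega
  · simp only [mul_pos_iff_of_pos_left h]
    exact hpos

/-- A planar configuration, flattened and placed to the left of an alternating configuration: the
plane through an edge of the first and a point of the second halves the second and cuts the
first like the edge. -/
theorem exists_spatial_configuration {ι : Type} [Finite ι] {p : ι → ℝ × ℝ} (hp : GenPos p)
    (j : ℕ) :
    ∃ c : ι ⊕ Fin (2 * j + 1) → Space3, GenPos3 c ∧ (∀ i, c (Sum.inl i) 0 < 0) ∧
      (∀ l, 0 < c (Sum.inr l) 0) ∧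
      (∀ l, ∃ s : ℝ, s ≠ 0 ∧ ∀ i i' k, i ≠ i' →
        (0 < s * volume4 (c (Sum.inr l)) (c (Sum.inl i)) (c (Sum.inl i')) (c (Sum.inl k)) ↔
          0 < orient (p i) (p i') (p k))) ∧
      ∀ l i i', i ≠ i' → ∃ s : ℝ, s ≠ 0 ∧ ∀ l',
        (0 < volume4 (c (Sum.inr l)) (c (Sum.inl i)) (c (Sum.inl i')) (c (Sum.inr l')) ↔
          0 < s * altSign l l') ∧
        (volume4 (c (Sum.inr l)) (c (Sum.inl i)) (c (Sum.inl i')) (c (Sum.inr l')) < 0 ↔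
          s * altSign l l' < 0) := by
  classical
  obtain ⟨M, hM⟩ : ∃ M, ∀ i, (p i).1 < M := by
    obtain ⟨M, hM⟩ := (Set.finite_range fun i => (p i).1).bddAbove
    exact ⟨M + 1, fun i => by linarith [hM ⟨i, rfl⟩]⟩
  -- The planar set lies in the plane `z = 0`, so a plane through one of its edges and a point
  -- outside cuts it like the edge. For `ε = 0` it collapses to the `x`-axis, and planes through
  -- this axis cut the second set as lines through the origin cut the vectors `(-1)ˡ (1, l + 1)`.
  -- The summand 1 keeps all of them off `z = 0`.
  let v : ℝ → ι ⊕ Fin (2 * j + 1) → Fin 4 → ℝ := fun ε =>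
    Sum.elim (fun i => ![1, (p i).1 - M, ε * (p i).2, 0])
      fun l => ![1, 1, (-1) ^ (l : ℕ), (-1) ^ (l : ℕ) * ((l : ℕ) + 1)]
  have hR : ∀ ε l i i' k, det4 (v ε (Sum.inr l)) (v ε (Sum.inl i)) (v ε (Sum.inl i'))
      (v ε (Sum.inl k)) =
      ε * (-((-1) ^ (l : ℕ) * ((l : ℕ) + 1))) * orient (p i) (p i') (p k) := by
    intro ε l i i' k
    simp [v, det4, det3, Fin.tail, orient]
    ring
  have hB : ∀ l i i' l', det4 (v 0 (Sum.inr l)) (v 0 (Sum.inl i)) (v 0 (Sum.inl i'))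
      (v 0 (Sum.inr l')) = ((p i').1 - (p i).1) * altSign l l' := by
    intro l i i' l'
    simp [v, det4, det3, Fin.tail, altSign]
    ring
  have hcont : ∀ l i i' l', Continuous fun ε => det4 (v ε (Sum.inr l)) (v ε (Sum.inl i))
      (v ε (Sum.inl i')) (v ε (Sum.inr l')) := by
    intro l i i' l'
    simp [v, det4, det3, Fin.tail]
    fun_prop
  have hBpos : ∀ᶠ ε in 𝓝[>] (0 : ℝ), ∀ (l : Fin (2 * j + 1)) i i' (l' : Fin (2 * j + 1)),
      0 < ((p i').1 - (p i).1) * altSign l l' →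
      0 < det4 (v ε (Sum.inr l)) (v ε (Sum.inl i)) (v ε (Sum.inl i')) (v ε (Sum.inr l')) := by
    simp only [eventually_all]
    intro l i i' l' h
    exact eventually_pos_of_continuous (hcont l i i' l') (by rwa [hB])
  have hBneg : ∀ᶠ ε in 𝓝[>] (0 : ℝ), ∀ (l : Fin (2 * j + 1)) i i' (l' : Fin (2 * j + 1)),
      ((p i').1 - (p i).1) * altSign l l' < 0 →
      det4 (v ε (Sum.inr l)) (v ε (Sum.inl i)) (v ε (Sum.inl i')) (v ε (Sum.inr l')) < 0 := by
    simp only [eventually_all]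
    intro l i i' l' h
    exact eventually_neg_of_continuous (hcont l i i' l') (by rwa [hB])
  obtain ⟨ε, hBpos, hBneg, hε⟩ := (hBpos.and (hBneg.and self_mem_nhdsWithin)).exists
  have hε : 0 < ε := hε
  obtain ⟨c, hc, hsign, hside⟩ := exists_genPos3_of_vectors (v ε) (by
    rintro (i | i) <;> simp [v])
  refine ⟨c, hc, fun i => (hside _).2 ?_, fun l => (hside _).1 ?_, fun l => ?_, fun l i i' hne => ?_⟩
  · simp [v, hM]
  · simp [v]
  · set s : ℝ := -((-1) ^ (l : ℕ) * ((l : ℕ) + 1)) with hs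
    have hs0 : s ≠ 0 := by
      rw [hs]
      refine neg_ne_zero.2 (mul_ne_zero (by simp) (by positivity))
    refine ⟨s, hs0, fun i i' k hne => ?_⟩
    obtain ⟨h1, h2⟩ := hsign (Sum.inr l) (Sum.inl i) (Sum.inl i') (Sum.inl k)
    rw [hR, mul_assoc] at h1 h2
    rw [mul_pos_iff_of_pos_left hε] at h1
    rw [mul_neg_left_of_pos hε] at h2
    rcases lt_trichotomy (orient (p i) (p i') (p k)) 0 with ho | ho | ho
    · refine iff_of_false (not_lt.2 ?_) (not_lt.2 ho.le)
      rcases lt_or_gt_of_ne hs0 with hs' | hs'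
      · exact mul_nonpos_of_nonpos_of_nonneg hs'.le (h1 (mul_pos_of_neg_of_neg hs' ho)).le
      · exact mul_nonpos_of_nonneg_of_nonpos hs'.le (h2 (mul_neg_of_pos_of_neg hs' ho)).le
    · refine iff_of_false (not_lt.2 (le_of_eq ?_)) (not_lt.2 ho.le)
      rcases (hp.orient_eq_zero_iff hne).1 ho with rfl | rfl <;>
      · simp only [volume4, det3]; ring
    · refine iff_of_true ?_ ho
      rcases lt_or_gt_of_ne hs0 with hs' | hs'
      · exact mul_pos_of_neg_of_neg hs' (h2 (mul_neg_of_neg_of_pos hs' ho))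
      · exact mul_pos hs' (h1 (mul_pos hs' ho))
  · refine ⟨(p i').1 - (p i).1, sub_ne_zero.2 fun h => hne (hp.fst_injective h.symm), fun l' => ?_⟩
    rcases lt_trichotomy (((p i').1 - (p i).1) * altSign l l') 0 with ho | ho | ho
    · have := (hsign _ _ _ _).2 (hBneg l i i' l' ho)
      exact ⟨iff_of_false (not_lt.2 this.le) (not_lt.2 ho.le), iff_of_true this ho⟩
    · have : altSign l l' = 0 := by
        rcases mul_eq_zero.1 ho with h | h
        · exact absurd (hp.fst_injective (sub_eq_zero.1 h)).symm hne
        · exact h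
      have : l' = l := Fin.ext (altSign_eq_zero_iff.1 this)
      subst this
      have h0 : volume4 (c (Sum.inr l')) (c (Sum.inl i)) (c (Sum.inl i')) (c (Sum.inr l')) = 0 := by
        simp only [volume4, det3]; ring
      rw [h0, ho]
      exact ⟨Iff.rfl, Iff.rfl⟩
    · have := (hsign _ _ _ _).1 (hBpos l i i' l' ho)
      exact ⟨iff_of_true this ho, iff_of_false (not_lt.2 this.le) (not_lt.2 ho.le)⟩

theorem GenPos3.injective_dualPlane {κ : Type*} {c : κ → Space3} (hc : GenPos3 c) :
    Function.Injective fun i => dualPlane (c i) :=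
  dualPlane_injective.comp hc.injective

/-- Each middle level edge and each of the `2j+1` alternating points determine a vertex. The factor
2 accounts for the two directions of an edge. -/
theorem mul_le_two_mul_ellStar (m j : ℕ) :
    (((h₂ m).toNat * (2 * j + 1) : ℕ) : ℕ∞) ≤ 2 * ellStar (m + (2 * j + 1)) := by
  classical
  obtain ⟨ι, _, p, hcard, hp, hh⟩ := exists_genPos_h₂_le m
  obtain ⟨c, hc, hneg, hpos, hcR, hcB⟩ := exists_spatial_configuration hp j
  set E := levelEdges (chirotope p) ((m - 2) / 2) with hE
  have hinj := hc.injective_dualPlane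
  set R : Set (Set Space3) := Set.range fun i => dualPlane (c (Sum.inl i)) with hRdef
  set B : Set (Set Space3) := Set.range fun l => dualPlane (c (Sum.inr l)) with hBdef
  have hinjR : Function.Injective fun i => dualPlane (c (Sum.inl i)) :=
    hinj.comp Sum.inl_injective
  have hinjB : Function.Injective fun l => dualPlane (c (Sum.inr l)) :=
    hinj.comp Sum.inr_injective
  have hRB : R ∪ B = Set.range fun i => dualPlane (c i) := by
    ext S; simp [hRdef, hBdef]
  have hdisj : Disjoint R B := by
    rw [Set.disjoint_left]
    rintro _ ⟨i, rfl⟩ ⟨l, hl⟩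
    exact Sum.inr_ne_inl (hinj hl)
  have hRf : R.Finite := Set.finite_range _
  have hf : (R ∪ B).Finite := hRf.union (Set.finite_range _)
  have hH : GeneralPosition3 (R ∪ B) := by rw [hRB]; exact hc.generalPosition3
  have hn : (R ∪ B).encard = ((m + (2 * j + 1) : ℕ) : ℕ∞) := by
    rw [hRB, encard_range hinj]
    simp [hcard]
  have hsep : StrictlySeparated (dualPoints R) (dualPoints B) := by
    refine ⟨!₂[1, 0, 0], 0, ?_, ?_, ?_⟩
    · intro h
      have := congrArg (fun x : Space3 => x 0) h
      simp at this
    · rintro q ⟨i, hi⟩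
      rw [← dualPlane_injective hi]
      simpa [inner_space3] using hneg i
    · rintro q ⟨l, hl⟩
      rw [← dualPlane_injective hl]
      simpa [inner_space3] using hpos l
  have hshadow : ∀ e ∈ E, ∀ l, shadow (c (Sum.inr l)) (c (Sum.inl e.1)) (c (Sum.inl e.2)) ≠ 0 := by
    intro e he l
    refine hc.shadow_ne_zero _ _ _ (by simp) (by simp) ?_
    simpa using (mem_levelEdges.1 he).1
  have hx : ∀ e l, e ∈ E → ∃ x, height (c (Sum.inr l)) x = 0 ∧ height (c (Sum.inl e.1)) x = 0 ∧
      height (c (Sum.inl e.2)) x = 0 := fun e l he => exists_common_point (hshadow e he l)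
  choose! X hXb hX1 hX2 using hx
  have hmem : ∀ e l, e ∈ E → X e l ∈ dualPlane (c (Sum.inr l)) ∧
      X e l ∈ dualPlane (c (Sum.inl e.1)) ∧ X e l ∈ dualPlane (c (Sum.inl e.2)) :=
    fun e l he => ⟨mem_dualPlane.2 (hXb e l he), mem_dualPlane.2 (hX1 e l he),
      mem_dualPlane.2 (hX2 e l he)⟩
  have hinc : ∀ e l, e ∈ E → ∀ k, X e l ∈ dualPlane (c k) →
      k = Sum.inr l ∨ k = Sum.inl e.1 ∨ k = Sum.inl e.2 := by
    intro e l he k hk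
    obtain ⟨h0, h1, h2⟩ := hmem e l he
    have hne := (mem_levelEdges.1 he).1
    have := (hRB ▸ hH).mem_triple ⟨Sum.inr l, rfl⟩ ⟨Sum.inl e.1, rfl⟩ ⟨Sum.inl e.2, rfl⟩
      (hinj.ne (by simp)) (hinj.ne (by simp)) (hinj.ne (by simpa using hne)) ⟨h0, h1, h2⟩
      ⟨k, rfl⟩ hk
    exact this.imp (fun h => hinj h) (Or.imp (fun h => hinj h) fun h => hinj h)
  -- Below the vertex are `β` planes of `R`, where `β` is `(m - 2)/2` rounded down or up, depending
  -- on a sign. Being on two planes of `R`, the vertex lies on the levels `β + 1` and `β + 2`; one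
  -- of them always has the index `(m - 1) / 2 + 1`.
  have hvert : ∀ e l, e ∈ E → X e l ∈ levelVertices R B ((m - 1) / 2 + 1) (j + 1) := by
    intro e l he
    obtain ⟨h0, h1, h2⟩ := hmem e l he
    obtain ⟨hne, hlevel⟩ := mem_levelEdges.1 he
    have hsh := hshadow e he l
    refine ⟨⟨_, Or.inr ⟨l, rfl⟩, _, Or.inl ⟨e.1, rfl⟩, _, Or.inl ⟨e.2, rfl⟩, hinj.ne (by simp),
      hinj.ne (by simp), hinj.ne (by simpa using hne), h0, h1, h2⟩, ?_, ?_⟩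
    · obtain ⟨d, hd₁, hd₂⟩ := exists_climb_ne_zero (p := c (Sum.inl e.1)) (q := c (Sum.inl e.2))
        (r := c (Sum.inr l)) (by
          refine hc.shadow_ne_zero _ _ _ ?_ (by simp) (by simp)
          simpa using hne)
      refine mem_kLevel_of_two hRf (fun S hS => hH.1 S (Or.inl hS)) ⟨e.1, rfl⟩ ⟨e.2, rfl⟩ h1 h2 ?_
        (d := d) ?_ ?_ ?_
      · rintro _ ⟨k, rfl⟩ hk
        rcases hinc e l he _ hk with h | h | h
        · exact absurd h (by simp)
        · left; dsimp only; rw [h]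
        · right; dsimp only; rw [h]
      · simpa only [dualPoint_dualPlane] using hd₁
      · simpa only [dualPoint_dualPlane] using hd₂
      · rw [hRdef, encard_sep_range hinjR]
        obtain ⟨s, hs, hsv⟩ := hcR l
        have hcount : (Finset.univ.filter fun i =>
              PassesBelow (dualPlane (c (Sum.inl i))) (X e l)).card =
            (Finset.univ.filter fun k => 0 < orient (p e.1) (p e.2) (p k)).card ∨
            (Finset.univ.filter fun i =>
              PassesBelow (dualPlane (c (Sum.inl i))) (X e l)).card =
            (Finset.univ.filter fun k => orient (p e.1) (p e.2) (p k) < 0).card := by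
          have hvol : ∀ k, (0 < s * shadow (c (Sum.inr l)) (c (Sum.inl e.1)) (c (Sum.inl e.2)) *
              height (c (Sum.inl k)) (X e l) ↔ 0 < orient (p e.1) (p e.2) (p k)) := fun k => by
            rw [← hsv _ _ k hne,
              volume4_eq_shadow_mul_height (hXb e l he) (hX1 e l he) (hX2 e l he), mul_assoc]
          -- The negative signs follow from the positive ones for the reversed edge.
          have hvol' : ∀ k, (s * shadow (c (Sum.inr l)) (c (Sum.inl e.1)) (c (Sum.inl e.2)) *
              height (c (Sum.inl k)) (X e l) < 0 ↔ orient (p e.1) (p e.2) (p k) < 0) := fun k => by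
            have h1 := hsv _ _ k hne.symm
            rw [orient_swap, neg_pos] at h1
            rw [← h1, volume4_eq_shadow_mul_height (hXb e l he) (hX2 e l he) (hX1 e l he),
              shadow_swap]
            constructor <;> intro h <;> nlinarith
          have hs' := mul_ne_zero hs hsh
          rcases lt_or_gt_of_ne hs' with h | h
          · right
            congr 1
            refine Finset.filter_congr fun k _ => ?_
            rw [passesBelow_dualPlane, ← hvol' k, mul_neg_left_of_neg h]
          · left
            congr 1
            refine Finset.filter_congr fun k _ => ?_
            rw [passesBelow_dualPlane, ← hvol k, mul_pos_iff_of_pos_left h]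
        have htot := hp.card_left_add_card_right hne
        have hlevel : (Finset.univ.filter fun k => 0 < orient (p e.1) (p e.2) (p k)).card =
          (m - 2) / 2 := hlevel
        norm_cast
        omega
    · refine mem_kLevel_of_unique ⟨l, rfl⟩ h0 ?_ ?_
      · rintro _ ⟨l', rfl⟩ hl'
        rcases hinc e l he _ hl' with h | h | h
        · dsimp only; rw [h]
        · exact absurd h (by simp)
        · exact absurd h (by simp)
      · rw [hBdef, encard_sep_range hinjB]
        obtain ⟨s, hs, hsv⟩ := hcB l e.1 e.2 hne
        have : (Finset.univ.filter fun l' =>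
            PassesBelow (dualPlane (c (Sum.inr l'))) (X e l)).card = j := by
          have hvol := fun l' =>
            volume4_eq_shadow_mul_height (hXb e l he) (hX1 e l he) (hX2 e l he) (c (Sum.inr l'))
          rcases lt_or_gt_of_ne hsh with h | h
          · refine Eq.trans ?_ (card_altSign l (neg_ne_zero.2 hs))
            congr 1
            refine Finset.filter_congr fun l' _ => ?_
            rw [passesBelow_dualPlane, ← mul_neg_left_of_neg h, ← hvol, (hsv l').2, neg_mul,
              neg_pos]
          · refine Eq.trans ?_ (card_altSign l hs)
            congr 1
            refine Finset.filter_congr fun l' _ => ?_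
            rw [passesBelow_dualPlane, ← mul_pos_iff_of_pos_left h, ← hvol, (hsv l').1]
        rw [this]
        norm_cast
  have hcount : (E ×ˢ (Finset.univ : Finset (Fin (2 * j + 1)))).card ≤
      2 * ((E ×ˢ (Finset.univ : Finset (Fin (2 * j + 1)))).image fun a => X a.1 a.2).card := by
    refine Finset.card_le_mul_card_image _ 2 fun x hx => ?_
    obtain ⟨⟨e, l⟩, he, rfl⟩ := Finset.mem_image.1 hx
    have he := (Finset.mem_product.1 he).1
    refine (Finset.card_le_card (t := {((e.1, e.2), l), ((e.2, e.1), l)}) ?_).trans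
      Finset.card_le_two
    rintro ⟨e', l'⟩ he'
    obtain ⟨he', hXX⟩ := Finset.mem_filter.1 he'
    have he' := (Finset.mem_product.1 he').1
    dsimp only at he he' hXX
    obtain ⟨h0, h1, h2⟩ := hmem e' l' he'
    rw [hXX] at h0 h1 h2
    have a0 := hinc e l he _ h0
    have a1 := hinc e l he _ h1
    have a2 := hinc e l he _ h2
    simp only [Sum.inr.injEq, reduceCtorEq, or_false, false_or, Sum.inl.injEq] at a0 a1 a2
    have hne' := (mem_levelEdges.1 he').1
    subst a0
    simp only [Finset.mem_insert, Finset.mem_singleton, Prod.mk.injEq, and_true]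
    rcases a1 with a1 | a1 <;> rcases a2 with a2 | a2
    · exact absurd (a1.trans a2.symm) hne'
    · left; exact Prod.ext a1 a2
    · right; exact Prod.ext a1 a2
    · exact absurd (a1.trans a2.symm) hne'
  rw [Finset.card_product, Finset.card_univ, Fintype.card_fin] at hcount
  have hle : (((E ×ˢ (Finset.univ : Finset (Fin (2 * j + 1)))).image fun a => X a.1 a.2).card : ℕ∞) ≤
      ellStar (m + (2 * j + 1)) := by
    refine le_trans ?_ (le_sSup ⟨R, B, (m - 1) / 2 + 1, j + 1, hdisj, hn, hH, hsep, rfl⟩)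
    rw [intersectionComplexity, encard_vertices hdisj hf hH, ← Set.encard_coe_eq_coe_finsetCard]
    refine le_trans (Set.encard_le_encard ?_) le_self_add
    intro x hx
    obtain ⟨⟨e, l⟩, he, rfl⟩ := Finset.mem_image.1 (Finset.mem_coe.1 hx)
    exact hvert e l (Finset.mem_product.1 he).1
  refine le_trans ?_ (mul_le_mul_right hle 2)
  norm_cast
  exact (Nat.mul_le_mul_right _ hh).trans hcount

/-! ### Finiteness and the main theorem -/

/-- A cell is determined by the set of planes containing it and the set of planes below it. -/
theorem encard_cells_le {H : Set (Set Space3)} {n : ℕ} (hH : H.encard = n) (d : ℕ) :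
    (cells H d).encard ≤ ((2 ^ n * 2 ^ n : ℕ) : ℕ∞) := by
  classical
  have hf : H.Finite := Set.finite_of_encard_eq_coe hH
  obtain ⟨A, rfl⟩ := hf.exists_finset_coe
  have hA : A.card = n := by
    rw [Set.encard_coe_eq_coe_finsetCard] at hH
    exact_mod_cast hH
  let g : Finset (Set Space3) × Finset (Set Space3) → Set Space3 := fun a =>
    {y | ∀ S ∈ A, (y ∈ S ↔ S ∈ a.1) ∧ (PassesBelow S y ↔ S ∈ a.2)}
  have hsub : cells (A : Set (Set Space3)) d ⊆
      ((A.powerset ×ˢ A.powerset).image g : Finset (Set Space3)) := by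
    rintro _ ⟨⟨x, rfl⟩, -⟩
    refine Finset.mem_coe.2 (Finset.mem_image.2
      ⟨(A.filter fun S => x ∈ S, A.filter fun S => PassesBelow S x), by simp, ?_⟩)
    ext y
    simp only [g, cellOf, Set.mem_ofPred_eq, Finset.mem_filter, Finset.mem_coe]
    exact forall₂_congr fun S hS => by simp [hS]
  refine (Set.encard_le_encard hsub).trans ?_
  rw [Set.encard_coe_eq_coe_finsetCard]
  refine Nat.cast_le.2 (Finset.card_image_le.trans_eq ?_)
  rw [Finset.card_product, Finset.card_powerset, hA]

theorem ellStar_ne_top (n : ℕ) : ellStar n ≠ ⊤ := by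
  refine ne_top_of_le_ne_top (ENat.natCast_ne_top (2 * (2 ^ n * 2 ^ n))) (sSup_le ?_)
  rintro c ⟨R, B, k, k', -, hn, -, -, rfl⟩
  rw [intersectionComplexity, two_mul, Nat.cast_add]
  exact add_le_add ((Set.encard_le_encard fun F hF => hF.1).trans (encard_cells_le hn 0))
    ((Set.encard_le_encard fun F hF => hF.1).trans (encard_cells_le hn 1))

theorem separatedComplexities_nonempty (n : ℕ) : (separatedComplexities n).Nonempty := by
  -- Any `n` planes in general position with dual points in `x < 0` serve as `R`, with `B` empty.
  obtain ⟨c, hc, -, hside⟩ := exists_genPos3_of_vectors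
    (fun _ : Fin n => ![0, -1, 0, 0]) (by simp)
  refine ⟨_, Set.range fun i => dualPlane (c i), ∅, 0, 0, Set.disjoint_empty _, ?_, ?_, ?_, rfl⟩
  · rw [Set.union_empty, encard_range hc.injective_dualPlane, Fintype.card_fin]
  · rw [Set.union_empty]; exact hc.generalPosition3
  · refine ⟨!₂[1, 0, 0], 0, ?_, ?_, ?_⟩
    · intro h
      have := congrArg (fun x : Space3 => x 0) h
      simp at this
    · rintro q ⟨i, hi⟩
      rw [← dualPlane_injective hi]
      simpa [inner_space3] using (hside i).2 (by simp)
    · rintro q hq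
      exact absurd hq (Set.notMem_empty _)

theorem isGreatest_ellStar (n : ℕ) : IsGreatest (separatedComplexities n) (ellStar n) :=
  isGreatest_sSup_of_ne_top (separatedComplexities_nonempty n) (ellStar_ne_top n)

theorem ellStar_toNat_le {n : ℕ} (hn : 1000 ≤ n) :
    (ellStar n).toNat ≤ 260 * 8 ^ 8 * (n * (h₂ n).toNat) := by
  have hC := edgeBound_of_le_three_mul (n := n) (m := n) (by omega) hn
  have h := le_of_mem_separatedComplexities hC (by omega) (isGreatest_ellStar n).1
  rw [← ENat.natCast_toNat (ellStar_ne_top n)] at h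
  have h : (ellStar n).toNat ≤ 260 * (8 ^ 8 * (h₂ n).toNat) * n := by exact_mod_cast h
  exact h.trans_eq (by ring)

theorem mul_h₂_toNat_le {n : ℕ} (hn : 3000 ≤ n) :
    n * (h₂ n).toNat ≤ 8 * 8 ^ 8 * (ellStar n).toNat := by
  -- Both classes get about `n/2` planes: the odd class has at least `n/4`, and `n ≤ 3m` with `m ≥
  -- 1000` permits replacing `h₂ n` by `h₂ m`.
  obtain ⟨m, hm⟩ : ∃ m, m + (2 * (n / 4) + 1) = n := ⟨n - (2 * (n / 4) + 1), by omega⟩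
  obtain ⟨ι, _, p, hcard, hp, hh⟩ := exists_genPos_h₂_le n
  have hC := edgeBound_of_le_three_mul (n := n) (m := m) (by omega) (by omega)
  have h1 : (h₂ n).toNat ≤ 8 ^ 8 * (h₂ m).toNat := hh.trans (hC ι p hp hcard.le _)
  have h2 := mul_le_two_mul_ellStar m (n / 4)
  rw [hm, ← ENat.natCast_toNat (ellStar_ne_top n)] at h2
  have h2 : (h₂ m).toNat * (2 * (n / 4) + 1) ≤ 2 * (ellStar n).toNat := by exact_mod_cast h2
  have h3 : n ≤ 4 * (2 * (n / 4) + 1) := by omega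
  calc n * (h₂ n).toNat ≤ 4 * (2 * (n / 4) + 1) * (8 ^ 8 * (h₂ m).toNat) := Nat.mul_le_mul h3 h1
    _ = 4 * 8 ^ 8 * ((h₂ m).toNat * (2 * (n / 4) + 1)) := by ring
    _ ≤ 4 * 8 ^ 8 * (2 * (ellStar n).toNat) := Nat.mul_le_mul_left _ h2
    _ = _ := by ring

/-- The suprema defining `h₂(n)` and `ℓ*(n)` are finite and attained, and `ℓ*(n) = Θ(n h₂(n))`. -/
theorem mainTheorem4 :
    (∀ n : ℕ, IsGreatest (halvingLineCounts n) (h₂ n) ∧ h₂ n ≠ ⊤) ∧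
    (∀ n : ℕ, IsGreatest (separatedComplexities n) (ellStar n) ∧ ellStar n ≠ ⊤) ∧
    (fun n : ℕ => ((ellStar n).toNat : ℝ)) =Θ[atTop]
      (fun n : ℕ => (n : ℝ) * ((h₂ n).toNat : ℝ)) := by
  refine ⟨fun n => ⟨isGreatest_h₂ n, h₂_ne_top n⟩,
    fun n => ⟨isGreatest_ellStar n, ellStar_ne_top n⟩, ?_, ?_⟩
  · refine IsBigO.of_bound (260 * 8 ^ 8) ?_
    filter_upwards [eventually_ge_atTop 1000] with n hn
    rw [Real.norm_of_nonneg (by positivity), Real.norm_of_nonneg (by positivity)]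
    exact_mod_cast ellStar_toNat_le hn
  · refine IsBigO.of_bound (8 * 8 ^ 8) ?_
    filter_upwards [eventually_ge_atTop 3000] with n hn
    rw [Real.norm_of_nonneg (by positivity), Real.norm_of_nonneg (by positivity)]
    exact_mod_cast mul_h₂_toNat_le hn
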